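/- **Instance.** Let $G=(V,E)$ be a finite simple graph with edge costs $c_e\ge 0$ and let $\mathcal D$ be a set of demand pairs $\{a,b\}\subseteq V$. A solution is an edge set $F\subseteq E$ such that both vertices of every demand pair lie in the same connected component of $(V,F)$; $c(F)=\sum_{e\in F}c_e$. Let $\mathrm{OPT}$ be a solution of minimum cost that is inclusionwise minimal among all solutions. A set $U\subseteq V$ separates a pair $d$ if exactly one vertex of $d$ lies in $U$; $\mathrm{sep}(U)$ is the set of demand pairs separated by $U$. **Extended moat growing.** Fix $\varepsilon\ge 0$. At time $t\ge 0$ let $\mathcal C^t$ be the set of (vertex sets of) connected components of the graph formed by the tight edges, i.e. the edges $e$ with $\sum_{U:e\in\delta(U)}y_U(t)=c_e$. Initially $y=0$ and all budgets are $0$. A component $S\in\mathcal C^t$ is demand-active if $\mathrm{sep}(S)\ne\emptyset$, and budget-active if it is not demand-active but its budget is positive; $\mathcal A^t\subseteq\mathcal C^t$ is the set of active components (demand-active or budget-active). The variables $y_S$ of all $S\in\mathcal A^t$ grow at unit rate; the budget of a demand-active component grows at rate $\varepsilon$, that of a budget-active component shrinks at unit rate, and when components merge, their budgets are added. ($\mathcal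 C^t$ and $\mathcal A^t$ are right-continuous in $t$.) Let $y$ be the final dual vector, $\mathcal U_{\rm sep}$ the set of $U\in\mathrm{supp}(y)$ with $\mathrm{sep}(U)\neq\emptyset$, and $\mathrm{excess}(\mathrm{OPT})=c(\mathrm{OPT})-\sum_{U\in\mathcal U_{\rm sep}}y_U$. The deactivation time $\mathrm{deac}_v$ of $v\in V$ is the largest $t$ such that $v$ lies in a set of $\mathcal A^s$ for every $0\le s<t$. Vertices $u,v$ are actively connected if, for some $t\le\min(\mathrm{deac}_u,\mathrm{deac}_v)$, they lie in a common set of $\mathcal C^t$. **Gain, cost, value.** For a collection $\mathcal S$ of vertex sets, $\mathrm{gain}(\mathcal S)=2\int_0^\infty(|\mathcal A^t|-|\mathcal A^t/\mathcal S|)\,dt$, where $\mathcal A^t/\mathcal S$ arises from $\mathcal A^t$ by merging sets whenever they are intersected by the same $S\in\mathcal S$. Let $\mathrm{cost}(S)$ be the minimum cost of an edge set in which all vertices of $S$ lie in one connected component, and $\mathrm{cost}(\mathcal S)=\sum_{S\in\mathcal S}\mathrm{cost}(S)$. Let $\varphi$ assign to every $U\in\mathcal U_{\rm sep}$ an arbitrary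 demand pair $\varphi(U)\in\mathrm{sep}(U)$. Let $\mathrm{val}(\mathcal S)$ be the sum of $\sum_{U\in\mathcal U_{\rm sep}:\varphi(U)=d}y_U$ over all demand pairs $d$ that are contained in some $S\in\mathcal S$. **Canonical collection.** Start with the connected components of $(V,\mathrm{OPT})$, each as its own forest; for each $U\in\mathcal U_{\rm sep}$ merge all forests that have a component containing a demand pair of $\mathrm{sep}(U)$. For each resulting forest $F$ let $r_F$ be an arbitrary vertex of $F$ of maximum deactivation time. Let $\mathcal S$ consist of the nonempty sets among $\{v\in V(T): v \text{ actively connected to } r_F\}$, over all forests $F$ and all connected components $T$ of $F$. **Autarkic collections.** An autarkic pair is a set $P=\{A,B\}$ of two disjoint sets in $\mathrm{supp}(y)$ with $A,B\in\mathcal A^t$ for some $t$ and $\mathrm{sep}(A)=\mathrm{sep}(B)\ne\emptyset$. An autarkic triple is a set $P=\{A_1,A_2,A_3\}$ of three pairwise disjoint sets, all in $\mathcal A^t$ for some $t$, with $\mathrm{sep}(A_i)\ne\emptyset$ for each $i$ and $\mathrm{sep}(A_1\cup A_2\cup A_3)=\emptyset$. An autarkic collection $\mathcal P$ is a set of autarkic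 pairs and triples; it is crossing-free if the sets $\mathrm{sep}(P)=\bigcup_{A\in P}\mathrm{sep}(A)$, $P\in\mathcal P$, are pairwise disjoint. Let $\mathrm{coverage}(\mathcal P)$ be the sum of $y_U$ over all $U\in\mathrm{supp}(y)$ with $\mathrm{sep}(U)=\mathrm{sep}(A)$ for some $A\in P\in\mathcal P$. For each $P\in\mathcal P$ and any two distinct $A,B\in P$ with $\mathrm{sep}(A)\cap\mathrm{sep}(B)\neq\emptyset$, a demand pair in $\mathrm{sep}(A)\cap\mathrm{sep}(B)$ is chosen as designated representative; $\mathrm{cost}(P)$ is the cost of a cheapest Steiner tree for the vertices of the representatives of $P$ (for an autarkic pair: the length of a shortest path between the two vertices of its representative). Let $\mathrm{profit}(\mathcal P)=2\,\mathrm{coverage}(\mathcal P)-\sum_{P\in\mathcal P}\mathrm{cost}(P)$. **Claim.** For every choice of $\varphi$ and of the vertices $r_F$ there exists a crossing-free autarkic collection $\mathcal P$ such that, for every choice of the designated representatives, $$\tfrac{10}{3}\bigl(\mathrm{gain}(\mathcal S)-\mathrm{cost}(\mathcal S)\bigr)+\mathrm{profit}(\mathcal P)+17\cdot\mathrm{excess}(\mathrm{OPT})\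 \ge\ \mathrm{val}(\mathcal S).$$ -/

import Mathlib

open scoped Classical in
/-- Merge the members of the family `C` along the relation `r`: two members end up in the same new
set iff they are joined by a chain of `r`-steps inside `C`; each class is replaced by its union. -/
noncomputable def mergeFamily {V : Type*} [DecidableEq V] (C : Finset (Finset V))
    (r : Finset V → Finset V → Prop) : Finset (Finset V) :=
  C.image fun A =>
    (C.filter fun B => Relation.EqvGen (fun X Y => X ∈ C ∧ Y ∈ C ∧ r X Y) A B).biUnion id

/-- `U` separates the two ends of `d`. For an edge `d` this says `d ∈ δ(U)`, for a demand pair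
it says that `U` separates the demand. -/
def Cuts {V : Type*} (U : Finset V) (d : Sym2 V) : Prop :=
  (∃ a ∈ d, a ∈ U) ∧ (∃ b ∈ d, b ∉ U)

/-- Both ends of `d` lie in `S`. -/
def Satisfies {V : Type*} (S : Finset V) (d : Sym2 V) : Prop := ∀ a ∈ d, a ∈ S

open scoped Classical in
/-- The vertex sets of the connected components of the graph `(V, F)`. -/
noncomputable def componentSets {V : Type*} [Fintype V] [DecidableEq V]
    (F : Finset (Sym2 V)) : Finset (Finset V) :=
  Finset.univ.image fun v : V =>
    Finset.univ.filter fun w : V => (SimpleGraph.fromEdgeSet (F : Set (Sym2 V))).Reachable v w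

/-- An instance of the Steiner forest problem on the vertex set `V`. -/
structure SteinerForest (V : Type*) where
  graph : SimpleGraph V
  edgeCost : Sym2 V → ℝ
  edgeCost_nonneg : ∀ e ∈ graph.edgeSet, 0 ≤ edgeCost e
  demands : Finset (Sym2 V)

/-- A state of the moat-growing algorithm: the current time, the current dual variables and the
current budgets (only the budgets of the current components are meaningful). -/
structure MoatState (V : Type*) where
  time : ℝ
  dual : Finset V → ℝ
  budget : Finset V → ℝ

namespace SteinerForest

variable {V : Type*} [Fintype V] [DecidableEq V] (I : SteinerForest V)

/-! ### Solutions and costs -/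

/-- The cost `c(F)` of an edge set. -/
def cost (F : Finset (Sym2 V)) : ℝ := ∑ e ∈ F, I.edgeCost e

/-- `F` is a set of edges of the graph that connects every demand pair. -/
def IsFeasible (F : Finset (Sym2 V)) : Prop :=
  (∀ e ∈ F, e ∈ I.graph.edgeSet) ∧
    ∀ a b : V, s(a, b) ∈ I.demands →
      (SimpleGraph.fromEdgeSet (F : Set (Sym2 V))).Reachable a b

/-- `F` is an optimum solution, and it is inclusionwise minimal among the feasible solutions. -/
def IsMinimalOptimum (F : Finset (Sym2 V)) : Prop :=
  I.IsFeasible F ∧ (∀ F', I.IsFeasible F' → I.cost F ≤ I.cost F') ∧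
    ∀ F', F' ⊂ F → ¬ I.IsFeasible F'

/-- The cost of a cheapest Steiner tree for `S`: the minimum cost of an edge set in which all
vertices of `S` lie in one connected component. For `S = {a, b}` this is the length of a shortest
`a`-`b` path. -/
noncomputable def steinerCost (S : Finset V) : ℝ :=
  sInf {x : ℝ | ∃ F : Finset (Sym2 V), (∀ e ∈ F, e ∈ I.graph.edgeSet) ∧
    (∀ u ∈ S, ∀ v ∈ S, (SimpleGraph.fromEdgeSet (F : Set (Sym2 V))).Reachable u v) ∧
    x = I.cost F}

/-- The cost of a collection of vertex sets. -/
noncomputable def collectionCost (𝒮 : Finset (Finset V)) : ℝ := ∑ S ∈ 𝒮, I.steinerCost S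

open scoped Classical in
/-- `sep(U)`: the demand pairs separated by `U`. -/
noncomputable def sep (U : Finset V) : Finset (Sym2 V) := I.demands.filter fun d => Cuts U d

/-! ### The `ε`-extended moat-growing algorithm

A state is recorded at time `0` and after every event. An event is the moment when an edge becomes
tight or the budget of a budget-active component is used up. Between events the components and
the active components do not change. -/

open scoped Classical in
/-- The total dual value packed into the edge `e`. -/
noncomputable def load (σ : MoatState V) (e : Sym2 V) : ℝ :=
  ∑ U : Finset V, if Cuts U e then σ.dual U else 0

open scoped Classical in
/-- The tight edges in a state. -/
noncomputable def tightEdges (σ : MoatState V) : Finset (Sym2 V) :=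
  Finset.univ.filter fun e => e ∈ I.graph.edgeSet ∧ load σ e = I.edgeCost e

/-- The connected components of the graph formed by the tight edges. -/
noncomputable def comps (σ : MoatState V) : Finset (Finset V) := componentSets (I.tightEdges σ)

/-- For a component `S` of the tight edges: some vertex of `S` has a partner outside `S`. -/
def DemandActive (S : Finset V) : Prop := (I.sep S).Nonempty

/-- Not demand-active, with a strictly positive budget. -/
def BudgetActive (σ : MoatState V) (S : Finset V) : Prop := ¬ I.DemandActive S ∧ 0 < σ.budget S

open scoped Classical in
/-- The active components in a state. -/
noncomputable def activeComps (σ : MoatState V) : Finset (Finset V) :=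
  (I.comps σ).filter fun S => I.DemandActive S ∨ I.BudgetActive σ S

open scoped Classical in
/-- The rate at which the load of `e` grows: the number of active components `S` with
`e ∈ δ(S)`. -/
noncomputable def growthRate (σ : MoatState V) (e : Sym2 V) : ℕ :=
  ((I.activeComps σ).filter fun S => Cuts S e).card

/-- The time until the next event: the least among the times after which some growing edge becomes
tight and the times after which some budget-active component runs out of budget. (It is `0` if
nothing is left to happen.) -/
noncomputable def delay (σ : MoatState V) : ℝ :=
  sInf ({d : ℝ | ∃ e ∈ I.graph.edgeSet, 0 < I.growthRate σ e ∧
          d = (I.edgeCost e - load σ e) / (I.growthRate σ e : ℝ)} ∪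
        {d : ℝ | ∃ S ∈ I.comps σ, I.BudgetActive σ S ∧ d = σ.budget S})

open scoped Classical in
/-- The budget of a component just before the next event: it grows at rate `ε` while
demand-active, shrinks at unit rate while budget-active, and is constant otherwise. -/
noncomputable def grownBudget (ε : ℝ) (σ : MoatState V) (S : Finset V) : ℝ :=
  if I.DemandActive S then σ.budget S + ε * I.delay σ
  else if I.BudgetActive σ S then σ.budget S - I.delay σ
  else σ.budget S

open scoped Classical in
/-- Run the growth until the next event; the budgets of merged components are added up. -/
noncomputable def nextState (ε : ℝ) (σ : MoatState V) : MoatState V where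
  time := σ.time + I.delay σ
  dual U := σ.dual U + if U ∈ I.activeComps σ then I.delay σ else 0
  budget C := ∑ S ∈ (I.comps σ).filter (fun S => S ⊆ C), I.grownBudget ε σ S

/-- The states of the run after `k` events, started with zero duals and zero budgets. -/
noncomputable def stage (ε : ℝ) (k : ℕ) : MoatState V :=
  (I.nextState ε)^[k] { time := 0, dual := fun _ => 0, budget := fun _ => 0 }

/-- The index of the last stage: nothing is active any more. -/
noncomputable def lastStage (ε : ℝ) : ℕ := sInf {k : ℕ | I.activeComps (I.stage ε k) = ∅}

/-- The index of the stage that is in force at time `t ≥ 0`: stage `k` is in force on the half-open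
time interval from its own time to the time of stage `k + 1`, the last one forever. -/
noncomputable def stageAt (ε t : ℝ) : ℕ :=
  sInf {k : ℕ | t < (I.stage ε (k + 1)).time ∨ I.activeComps (I.stage ε k) = ∅}

/-- The components `𝒞ᵗ` at time `t`. -/
noncomputable def compsAt (ε t : ℝ) : Finset (Finset V) := I.comps (I.stage ε (I.stageAt ε t))

/-- The active components `𝒜ᵗ` at time `t`. -/
noncomputable def activeAt (ε t : ℝ) : Finset (Finset V) :=
  I.activeComps (I.stage ε (I.stageAt ε t))

/-- The dual solution `y` when the algorithm terminates. -/
noncomputable def y (ε : ℝ) (U : Finset V) : ℝ := (I.stage ε (I.lastStage ε)).dual U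

open scoped Classical in
/-- The support of `y`. -/
noncomputable def supp (ε : ℝ) : Finset (Finset V) :=
  Finset.univ.filter fun U => I.y ε U ≠ 0

open scoped Classical in
/-- The sets in the support of `y` that separate some demand pair. -/
noncomputable def sepSupp (ε : ℝ) : Finset (Finset V) :=
  (I.supp ε).filter fun U => (I.sep U).Nonempty

/-- `excess(F) = c(F) - y(𝒰_sep)`. -/
noncomputable def excess (ε : ℝ) (F : Finset (Sym2 V)) : ℝ :=
  I.cost F - ∑ U ∈ I.sepSupp ε, I.y ε U

/-! ### Actively connected vertices and gain -/

/-- The deactivation time of `v`. -/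
noncomputable def deac (ε : ℝ) (v : V) : ℝ :=
  sSup {t : ℝ | 0 ≤ t ∧ ∀ s, 0 ≤ s → s < t → ∃ S ∈ I.activeAt ε s, v ∈ S}

/-- `u` and `v` are actively connected. -/
def ActivelyConnected (ε : ℝ) (u v : V) : Prop :=
  ∃ t : ℝ, 0 ≤ t ∧ (∃ S ∈ I.compsAt ε t, u ∈ S ∧ v ∈ S) ∧ t ≤ I.deac ε u ∧ t ≤ I.deac ε v

/-- `𝒜ᵗ / 𝒮`: merge the sets of `𝒜ᵗ` that are intersected by a common `S ∈ 𝒮`. -/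
noncomputable def activeContract (ε t : ℝ) (𝒮 : Finset (Finset V)) : Finset (Finset V) :=
  mergeFamily (I.activeAt ε t) fun A B => ∃ S ∈ 𝒮, (A ∩ S).Nonempty ∧ (B ∩ S).Nonempty

/-- `gain(𝒮)`. -/
noncomputable def gain (ε : ℝ) (𝒮 : Finset (Finset V)) : ℝ :=
  2 * ∫ t in Set.Ioi (0 : ℝ),
    (((I.activeAt ε t).card : ℝ) - ((I.activeContract ε t 𝒮).card : ℝ))

/-! ### The value and the canonical collection -/

/-- `φ` assigns to every set of `𝒰_sep` a demand pair that it separates. -/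
def IsResponsible (ε : ℝ) (φ : Finset V → Sym2 V) : Prop :=
  ∀ U ∈ I.sepSupp ε, φ U ∈ I.sep U

open scoped Classical in
/-- The value of a demand pair. -/
noncomputable def demandVal (ε : ℝ) (φ : Finset V → Sym2 V) (d : Sym2 V) : ℝ :=
  ∑ U ∈ (I.sepSupp ε).filter (fun U => φ U = d), I.y ε U

open scoped Classical in
/-- The value of a collection of vertex sets. -/
noncomputable def val (ε : ℝ) (φ : Finset V → Sym2 V) (𝒮 : Finset (Finset V)) : ℝ :=
  ∑ d ∈ I.demands.filter (fun d => ∃ S ∈ 𝒮, Satisfies S d), I.demandVal ε φ d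

/-- The vertex sets of the forests obtained from the components of `OPT` by merging, for each
`U ∈ 𝒰_sep`, all those that connect a demand pair separated by `U`. -/
noncomputable def forests (ε : ℝ) (OPT : Finset (Sym2 V)) : Finset (Finset V) :=
  mergeFamily (componentSets OPT) fun T T' => ∃ U ∈ I.sepSupp ε,
    (∃ d ∈ I.sep U, Satisfies T d) ∧ (∃ d' ∈ I.sep U, Satisfies T' d')

/-- `r` picks in every forest a vertex of maximum deactivation time. -/
def IsRootChoice (ε : ℝ) (OPT : Finset (Sym2 V)) (r : Finset V → V) : Prop :=
  ∀ F ∈ I.forests ε OPT, r F ∈ F ∧ ∀ v ∈ F, I.deac ε v ≤ I.deac ε (r F)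

open scoped Classical in
/-- The canonical collection: for each forest `F` and each component `T` of `OPT` in `F`, the set of
the vertices of `T` that are actively connected to `r F`, if it is nonempty. -/
noncomputable def canonical (ε : ℝ) (OPT : Finset (Sym2 V)) (r : Finset V → V) :
    Finset (Finset V) :=
  ((I.forests ε OPT).biUnion fun F =>
    ((componentSets OPT).filter fun T => T ⊆ F).image fun T =>
      T.filter fun v => I.ActivelyConnected ε v (r F)).filter fun S => S.Nonempty

/-! ### Autarkic collections -/

/-- An autarkic pair. -/
def IsAutarkicPair (ε : ℝ) (P : Finset (Finset V)) : Prop :=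
  ∃ A B : Finset V, P = {A, B} ∧ A ∈ I.supp ε ∧ B ∈ I.supp ε ∧ Disjoint A B ∧
    (∃ t : ℝ, 0 ≤ t ∧ A ∈ I.activeAt ε t ∧ B ∈ I.activeAt ε t) ∧
    I.sep A = I.sep B ∧ (I.sep A).Nonempty

/-- An autarkic triple. -/
def IsAutarkicTriple (ε : ℝ) (P : Finset (Finset V)) : Prop :=
  ∃ A B C : Finset V, P = {A, B, C} ∧ Disjoint A B ∧ Disjoint A C ∧ Disjoint B C ∧
    (∃ t : ℝ, 0 ≤ t ∧ A ∈ I.activeAt ε t ∧ B ∈ I.activeAt ε t ∧ C ∈ I.activeAt ε t) ∧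
    (I.sep A).Nonempty ∧ (I.sep B).Nonempty ∧ (I.sep C).Nonempty ∧ I.sep (A ∪ B ∪ C) = ∅

/-- A collection of autarkic pairs and triples. -/
def IsAutarkicCollection (ε : ℝ) (Ps : Finset (Finset (Finset V))) : Prop :=
  ∀ P ∈ Ps, I.IsAutarkicPair ε P ∨ I.IsAutarkicTriple ε P

/-- `sep(P)`: the union of the `sep(A)` for `A ∈ P`. -/
noncomputable def tupleSep (P : Finset (Finset V)) : Finset (Sym2 V) := P.biUnion I.sep

/-- Different tuples separate no common demand pair. -/
def IsCrossingFree (Ps : Finset (Finset (Finset V))) : Prop :=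
  ∀ P ∈ Ps, ∀ Q ∈ Ps, P ≠ Q → Disjoint (I.tupleSep P) (I.tupleSep Q)

open scoped Classical in
/-- `coverage(Ps)`. -/
noncomputable def coverage (ε : ℝ) (Ps : Finset (Finset (Finset V))) : ℝ :=
  ∑ U ∈ (I.supp ε).filter (fun U => ∃ P ∈ Ps, ∃ A ∈ P, I.sep A = I.sep U), I.y ε U

/-- `rep` chooses the designated representatives: for each tuple and each two of its sets that
separate a common demand pair, such a demand pair. -/
def IsRepresentation (Ps : Finset (Finset (Finset V)))
    (rep : Finset (Finset V) → Sym2 (Finset V) → Sym2 V) : Prop :=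
  ∀ P ∈ Ps, ∀ A ∈ P, ∀ B ∈ P, A ≠ B → (I.sep A ∩ I.sep B).Nonempty →
    rep P s(A, B) ∈ I.sep A ∩ I.sep B

open scoped Classical in
/-- The vertices joined by the connector of `P`: the ends of its designated representatives. -/
noncomputable def repVertices (rep : Finset (Finset V) → Sym2 (Finset V) → Sym2 V)
    (P : Finset (Finset V)) : Finset V :=
  Finset.univ.filter fun v => ∃ A ∈ P, ∃ B ∈ P, A ≠ B ∧ (I.sep A ∩ I.sep B).Nonempty ∧
    v ∈ rep P s(A, B)

/-- The total cost of the connectors. For a pair the connector is a shortest path between the two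
ends of its only representative. -/
noncomputable def tupleCost (rep : Finset (Finset V) → Sym2 (Finset V) → Sym2 V)
    (Ps : Finset (Finset (Finset V))) : ℝ :=
  ∑ P ∈ Ps, I.steinerCost (I.repVertices rep P)

/-- `profit(Ps) = 2 coverage(Ps) - cost(Ps)`. -/
noncomputable def profit (ε : ℝ) (rep : Finset (Finset V) → Sym2 (Finset V) → Sym2 V)
    (Ps : Finset (Finset (Finset V))) : ℝ :=
  2 * I.coverage ε Ps - I.tupleCost rep Ps

end SteinerForest

/-! The run has finitely many stages with fixed components. Summing over stages (duration times a
count over active components) expresses gain and value exactly, and expresses the cost of an edge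
set and the excess up to nonnegative unused edge capacities (`gain_eq`, `val_eq`, `cost_eq`,
`excess_eq`). So it suffices to compare counts. Fix a stage and let a set `S` of the collection
touch `K` active components; the sets with `K ≥ 2` are called spread. The surplus of an active
component `A` is the number of edges of OPT leaving it, less one if `A` separates a demand pair. The
excess is the slack of OPT plus the accumulated surplus, so surplus is an error term.

Gain against cost: the sets of the collection lie in distinct components of OPT, so minimal
connectors taken inside OPT are edge-disjoint. A minimal connector crossing `A` exactly once belongs
to a spread set meeting `A`; everything else is charged to surplus. Up to twice the surplus, gain
minus cost therefore grows at rate at least the sum of `K - 2` over spread sets (`stage_gain`),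
while value grows at rate at most the sum of `K` (`stage_val`). Since `10/3 (K - 2) - K` is negative
only for `K = 2`, where it is `-2`, only bisected sets need help.

The help comes from autarkic tuples. Call `S` clean if no component it touches has surplus; unclean
spread sets are few (`stage_not_clean`). If `S` is clean and spread, each touched component is left
by one edge of OPT and separates only demand pairs inside `S`, so what it separates depends only on
its trace on `S` (`sep_nonempty_of_clean`). Hence `K = 2` yields an autarkic pair and `K = 3` a
triple. Traces only merge over time, and any proper union of at most three parts is a part or the
complement of one, so a tuple from one stage also covers later clean stages (`exists_sep_eq_of_le`).

Let `g3` and `g4` be the clean time with `K = 3` and with `K ≥ 4`. After paying connectors, a pair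
leaves at least `(2 g4 - 5 g3)/3` and a triple at least `(10 g3 - 4 g4)/3`. One of these is
nonnegative, and `10/3` is the least factor for which the two bounds always complement each other
(`exists_autarkic`). -/

/-- `u` and `v` lie in the same connected component of the graph `(V, F)`. -/
abbrev Joins {V : Type*} (F : Finset (Sym2 V)) (u v : V) : Prop :=
  (SimpleGraph.fromEdgeSet (F : Set (Sym2 V))).Reachable u v

open scoped Classical in
/-- The edges of `F` in the cut `δ(A)`. -/
noncomputable def cutEdges {V : Type*} (F : Finset (Sym2 V)) (A : Finset V) : Finset (Sym2 V) :=
  F.filter fun e => Cuts A e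

/-! ### Cuts, connectivity and minimal connectors. -/

section Graph

variable {V : Type*}

theorem cuts_mk {A : Finset V} {a b : V} :
    Cuts A s(a, b) ↔ (a ∈ A ∧ b ∉ A) ∨ (b ∈ A ∧ a ∉ A) := by
  simp only [Cuts, Sym2.mem_iff]
  constructor
  · rintro ⟨⟨x, rfl | rfl, hx⟩, ⟨y, rfl | rfl, hy⟩⟩ <;> tauto
  · rintro (⟨h1, h2⟩ | ⟨h1, h2⟩)
    · exact ⟨⟨a, Or.inl rfl, h1⟩, ⟨b, Or.inr rfl, h2⟩⟩
    · exact ⟨⟨b, Or.inr rfl, h1⟩, ⟨a, Or.inl rfl, h2⟩⟩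

theorem Cuts.exists_mk {A : Finset V} {e : Sym2 V} (h : Cuts A e) :
    ∃ a b, e = s(a, b) ∧ a ∈ A ∧ b ∉ A := by
  obtain ⟨⟨a, ha, haA⟩, b, hb, hbA⟩ := h
  have hab : a ≠ b := by rintro rfl; exact hbA haA
  exact ⟨a, b, (Sym2.mem_and_mem_iff hab).1 ⟨ha, hb⟩, haA, hbA⟩

theorem Joins.mono {F G : Finset (Sym2 V)} (h : F ⊆ G) {u v : V} (huv : Joins F u v) :
    Joins G u v :=
  SimpleGraph.Reachable.mono (SimpleGraph.fromEdgeSet_mono (by exact_mod_cast h)) huv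

theorem joins_of_mem {F : Finset (Sym2 V)} {u v : V} (h : s(u, v) ∈ F) : Joins F u v := by
  by_cases huv : u = v
  · subst huv; exact SimpleGraph.Reachable.refl _
  · exact SimpleGraph.Adj.reachable ((SimpleGraph.fromEdgeSet_adj _).2 ⟨by exact_mod_cast h, huv⟩)

/-- Induction along a walk in `(V, F)`. -/
theorem Joins.induct {F : Finset (Sym2 V)} {u : V} {p : V → Prop} (hu : p u)
    (step : ∀ v w, p v → s(v, w) ∈ F → p w) {v : V} (h : Joins F u v) : p v := by
  obtain ⟨q⟩ := h
  induction q with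
  | nil => exact hu
  | cons hadj q ih =>
    exact ih (step _ _ hu (by exact_mod_cast ((SimpleGraph.fromEdgeSet_adj _).1 hadj).1))

theorem Joins.exists_cut {F : Finset (Sym2 V)} {A : Finset V} {u v : V} (h : Joins F u v)
    (hu : u ∈ A) (hv : v ∉ A) : (cutEdges F A).Nonempty := by
  classical
  by_contra hne
  rw [Finset.not_nonempty_iff_eq_empty, cutEdges, Finset.filter_eq_empty_iff] at hne
  refine hv (Joins.induct (p := fun w => w ∈ A) hu (fun x w hx hxw => ?_) h)
  by_contra hw
  exact hne hxw (cuts_mk.2 (Or.inl ⟨hx, hw⟩))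

/-- Two vertices on the same side of a cut with a single edge are joined without that edge. -/
theorem Joins.erase_of_side [DecidableEq V] {F : Finset (Sym2 V)} {p : V → Prop} {a b : V}
    (ha : p a) (hb : ¬ p b)
    (huniq : ∀ x y, s(x, y) ∈ F → p x → ¬ p y → s(x, y) = s(a, b)) {u v : V}
    (h : Joins F u v) (hu : p u) (hv : p v) : Joins (F.erase s(a, b)) u v := by
  -- Invariant along the walk: on the side of `u`, the erased edge has not been needed; on the other
  -- side, it has been needed once, to pass from `a` to `b`.
  have key : (p v ∧ Joins (F.erase s(a, b)) u v) ∨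
      (¬ p v ∧ Joins (F.erase s(a, b)) u a ∧ Joins (F.erase s(a, b)) b v) := by
    refine Joins.induct (p := fun w => (p w ∧ Joins (F.erase s(a, b)) u w) ∨
      (¬ p w ∧ Joins (F.erase s(a, b)) u a ∧ Joins (F.erase s(a, b)) b w))
      (Or.inl ⟨hu, SimpleGraph.Reachable.refl _⟩) ?_ h
    intro x y hx hxy
    by_cases he : s(x, y) = s(a, b)
    · rcases Sym2.eq_iff.1 he with ⟨rfl, rfl⟩ | ⟨rfl, rfl⟩
      · rcases hx with hx | hx
        · exact Or.inr ⟨hb, hx.2, SimpleGraph.Reachable.refl _⟩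
        · exact absurd ha hx.1
      · rcases hx with hx | hx
        · exact absurd hx.1 hb
        · exact Or.inl ⟨ha, hx.2.1⟩
    · have hj : Joins (F.erase s(a, b)) x y := joins_of_mem (Finset.mem_erase.2 ⟨he, hxy⟩)
      have hside : p x ↔ p y := by
        constructor
        · intro h1; by_contra h2; exact he (huniq _ _ hxy h1 h2)
        · intro h1; by_contra h2
          exact he (by rw [Sym2.eq_swap]; exact huniq _ _ (by rwa [Sym2.eq_swap]) h1 h2)
      rcases hx with hx | hx
      · exact Or.inl ⟨hside.1 hx.1, hx.2.trans hj⟩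
      · exact Or.inr ⟨fun h => hx.1 (hside.2 h), hx.2.1, hx.2.2.trans hj⟩
  rcases key with h | h
  · exact h.2
  · exact absurd hv h.1

/-- An inclusionwise minimal subset of `F` that connects `R` never crosses, in a single edge, a set
that does not separate `R`. -/
theorem exists_minimal_connector [DecidableEq V] (F : Finset (Sym2 V)) (R : Finset V)
    (h : ∀ u ∈ R, ∀ v ∈ R, Joins F u v) :
    ∃ X ⊆ F, (∀ u ∈ R, ∀ v ∈ R, Joins X u v) ∧
      ∀ A : Finset V, (Disjoint R A ∨ R ⊆ A) → (cutEdges X A).card ≠ 1 := by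
  classical
  obtain ⟨X, hX, hmin⟩ := Finset.exists_min_image
    (F.powerset.filter fun X => ∀ u ∈ R, ∀ v ∈ R, Joins X u v) Finset.card
    ⟨F, Finset.mem_filter.2 ⟨Finset.mem_powerset_self F, h⟩⟩
  obtain ⟨hXF, hXR⟩ := Finset.mem_filter.1 hX
  rw [Finset.mem_powerset] at hXF
  refine ⟨X, hXF, hXR, fun A hA hcard => ?_⟩
  obtain ⟨e, he⟩ := Finset.card_eq_one.1 hcard
  have hmem : ∀ f, f ∈ X → Cuts A f → f = e := fun f hf hfA => by
    have : f ∈ cutEdges X A := Finset.mem_filter.2 ⟨hf, hfA⟩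
    rw [he] at this
    exact Finset.mem_singleton.1 this
  have heX : e ∈ X ∧ Cuts A e := Finset.mem_filter.1 (he ▸ Finset.mem_singleton_self e :
    e ∈ cutEdges X A)
  obtain ⟨a, b, rfl, ha, hb⟩ := heX.2.exists_mk
  have hnew : X.erase s(a, b) ∈ F.powerset.filter fun X => ∀ u ∈ R, ∀ v ∈ R, Joins X u v := by
    refine Finset.mem_filter.2 ⟨Finset.mem_powerset.2 ((Finset.erase_subset _ _).trans hXF), ?_⟩
    intro u hu v hv
    -- In both cases `R` lies on one side of the cut, so the only cut edge is superfluous. If `R`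
    -- misses `A`, that side is the complement of `A`, and the ends of the edge change roles.
    rcases hA with hA | hA
    · have := Joins.erase_of_side (F := X) (p := fun x => x ∉ A) (a := b) (b := a) hb
        (by simpa using ha) (fun x y hxy hx hy => by
          rw [Sym2.eq_swap (a := b)]
          exact hmem _ hxy (cuts_mk.2 (Or.inr ⟨by simpa using hy, hx⟩))) (hXR u hu v hv)
        (Finset.disjoint_left.1 hA hu) (Finset.disjoint_left.1 hA hv)
      rwa [Sym2.eq_swap (a := b)] at this
    · exact Joins.erase_of_side (F := X) (p := fun x => x ∈ A) ha hb (fun x y hxy hx hy =>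
          hmem _ hxy (cuts_mk.2 (Or.inl ⟨hx, hy⟩))) (hXR u hu v hv) (hA hu) (hA hv)
  have := hmin _ hnew
  have h2 := Finset.card_erase_lt_of_mem heX.1
  omega

variable [Fintype V] [DecidableEq V]

theorem mem_componentSets {F : Finset (Sym2 V)} {S : Finset V} :
    S ∈ componentSets F ↔ S.Nonempty ∧ ∀ u ∈ S, ∀ v, v ∈ S ↔ Joins F u v := by
  classical
  simp only [componentSets, Finset.mem_image, Finset.mem_univ, true_and]
  constructor
  · rintro ⟨u, rfl⟩
    refine ⟨⟨u, by simp⟩, fun v hv w => ?_⟩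
    simp only [Finset.mem_filter, Finset.mem_univ, true_and] at hv ⊢
    exact ⟨fun h => hv.symm.trans h, fun h => hv.trans h⟩
  · rintro ⟨⟨u, hu⟩, h⟩
    exact ⟨u, by ext w; simpa using (h u hu w).symm⟩

theorem exists_componentSet (F : Finset (Sym2 V)) (v : V) : ∃ S ∈ componentSets F, v ∈ S := by
  classical
  exact ⟨_, Finset.mem_image_of_mem _ (Finset.mem_univ v), by simp⟩

theorem componentSets_eq_of_mem {F : Finset (Sym2 V)} {S T : Finset V} (hS : S ∈ componentSets F)
    (hT : T ∈ componentSets F) {v : V} (hvS : v ∈ S) (hvT : v ∈ T) : S = T := by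
  ext w
  rw [(mem_componentSets.1 hS).2 v hvS, (mem_componentSets.1 hT).2 v hvT]

theorem componentSets_disjoint {F : Finset (Sym2 V)} {S T : Finset V} (hS : S ∈ componentSets F)
    (hT : T ∈ componentSets F) (h : S ≠ T) : Disjoint S T :=
  Finset.disjoint_left.2 fun _ h1 h2 => h (componentSets_eq_of_mem hS hT h1 h2)

theorem not_cuts_of_mem_componentSets {F : Finset (Sym2 V)} {S : Finset V}
    (hS : S ∈ componentSets F) {e : Sym2 V} (he : e ∈ F) : ¬ Cuts S e := by
  intro h
  obtain ⟨a, b, rfl, ha, hb⟩ := h.exists_mk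
  exact hb (((mem_componentSets.1 hS).2 a ha b).2 (joins_of_mem he))

open scoped Classical in
/-- The vertices of a component `T` of `(V, F)` are joined by the edges of `F` inside `T`. -/
theorem joins_filter_satisfies {F : Finset (Sym2 V)} {T : Finset V} (hT : T ∈ componentSets F)
    {u v : V} (hu : u ∈ T) (hv : v ∈ T) : Joins (F.filter fun e => Satisfies T e) u v := by
  have h := ((mem_componentSets.1 hT).2 u hu v).1 hv
  refine (Joins.induct (p := fun w => w ∈ T ∧ Joins (F.filter fun e => Satisfies T e) u w)
    ⟨hu, SimpleGraph.Reachable.refl _⟩ ?_ h).2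
  rintro x y ⟨hx, hux⟩ hxy
  have hy : y ∈ T := ((mem_componentSets.1 hT).2 x hx y).2 (joins_of_mem hxy)
  refine ⟨hy, hux.trans (joins_of_mem (Finset.mem_filter.2 ⟨hxy, ?_⟩))⟩
  intro a ha
  rcases Sym2.mem_iff.1 ha with rfl | rfl <;> assumption

end Graph

namespace SteinerForest

variable {V : Type*} [Fintype V] [DecidableEq V] (I : SteinerForest V)

/-! ### One step of the algorithm -/

section Step

open scoped Classical

variable (σ : MoatState V)

omit [DecidableEq V] in
theorem mem_tightEdges {e : Sym2 V} :
    e ∈ I.tightEdges σ ↔ e ∈ I.graph.edgeSet ∧ load σ e = I.edgeCost e := by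
  simp [tightEdges]

theorem mem_activeComps {S : Finset V} :
    S ∈ I.activeComps σ ↔ S ∈ I.comps σ ∧ (I.DemandActive S ∨ I.BudgetActive σ S) := by
  simp [activeComps]

theorem activeComps_subset : I.activeComps σ ⊆ I.comps σ := Finset.filter_subset _ _

theorem not_mem_tightEdges_of_cuts {S : Finset V} (hS : S ∈ I.comps σ) {e : Sym2 V}
    (h : Cuts S e) : e ∉ I.tightEdges σ :=
  fun he => not_cuts_of_mem_componentSets hS he h

theorem growthRate_pos {e : Sym2 V} :
    0 < I.growthRate σ e ↔ ∃ S ∈ I.activeComps σ, Cuts S e := by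
  simp [growthRate, Finset.card_pos, Finset.Nonempty, Finset.mem_filter]

theorem load_nextState (ε : ℝ) (e : Sym2 V) :
    load (I.nextState ε σ) e = load σ e + I.growthRate σ e * I.delay σ := by
  have h : ∀ U : Finset V, (if Cuts U e then (I.nextState ε σ).dual U else 0) =
      (if Cuts U e then σ.dual U else 0) +
        (if U ∈ I.activeComps σ ∧ Cuts U e then I.delay σ else 0) := by
    intro U
    by_cases h1 : Cuts U e <;> by_cases h2 : U ∈ I.activeComps σ <;> simp [nextState, h1, h2]
  simp only [load, h, Finset.sum_add_distrib, growthRate]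
  congr 1
  rw [← Finset.sum_filter, Finset.sum_const, nsmul_eq_mul]
  congr 2
  congr 1
  ext U
  simp

/-- The waiting times whose infimum is `delay`. -/
def delaySet : Set ℝ :=
  {d : ℝ | ∃ e ∈ I.graph.edgeSet, 0 < I.growthRate σ e ∧
      d = (I.edgeCost e - load σ e) / (I.growthRate σ e : ℝ)} ∪
    {d : ℝ | ∃ S ∈ I.comps σ, I.BudgetActive σ S ∧ d = σ.budget S}

theorem delaySet_finite : (I.delaySet σ).Finite := by
  refine Set.Finite.union ?_ ?_
  · refine (Set.finite_range fun e : Sym2 V =>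
      (I.edgeCost e - load σ e) / (I.growthRate σ e : ℝ)).subset ?_
    rintro d ⟨e, -, -, rfl⟩
    exact ⟨e, rfl⟩
  · refine (Set.finite_range fun S : Finset V => σ.budget S).subset ?_
    rintro d ⟨S, -, -, rfl⟩
    exact ⟨S, rfl⟩

/-- No edge is overpacked. -/
def IsPacked : Prop := ∀ e ∈ I.graph.edgeSet, load σ e ≤ I.edgeCost e

variable {σ}

/-- A growing edge leaves a component of the tight edges, so it is not tight; as nothing is
overpacked, it has capacity left. -/
theorem delaySet_pos (hσ : I.IsPacked σ) {d : ℝ} (hd : d ∈ I.delaySet σ) : 0 < d := by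
  rcases hd with ⟨e, he, hpos, rfl⟩ | ⟨S, -, hS, rfl⟩
  · obtain ⟨S, hS, hSe⟩ := (I.growthRate_pos σ).1 hpos
    have hne := I.not_mem_tightEdges_of_cuts σ (I.activeComps_subset σ hS) hSe
    rw [mem_tightEdges] at hne
    have hlt : load σ e < I.edgeCost e := lt_of_le_of_ne (hσ e he) fun h => hne ⟨he, h⟩
    have : (0 : ℝ) < I.growthRate σ e := by exact_mod_cast hpos
    exact div_pos (by linarith) this
  · exact hS.2

theorem delay_le {d : ℝ} (hd : d ∈ I.delaySet σ) : I.delay σ ≤ d :=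
  csInf_le (I.delaySet_finite σ).bddBelow hd

theorem isPacked_nextState (hσ : I.IsPacked σ) (ε : ℝ) : I.IsPacked (I.nextState ε σ) := by
  intro e he
  rw [load_nextState]
  rcases Nat.eq_zero_or_pos (I.growthRate σ e) with h | h
  · simpa [h] using hσ e he
  · have h1 : I.delay σ ≤ _ := I.delay_le (Or.inl ⟨e, he, h, rfl⟩)
    have : (0 : ℝ) < I.growthRate σ e := by exact_mod_cast h
    rw [le_div_iff₀ this] at h1
    linarith

/-- A tight edge leaves no component, so its load is frozen. -/
theorem tightEdges_subset_nextState (ε : ℝ) :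
    I.tightEdges σ ⊆ I.tightEdges (I.nextState ε σ) := by
  intro e he
  have h : I.growthRate σ e = 0 := by
    by_contra h
    obtain ⟨S, hS, hSe⟩ := (I.growthRate_pos σ).1 (Nat.pos_of_ne_zero h)
    exact I.not_mem_tightEdges_of_cuts σ (I.activeComps_subset σ hS) hSe he
  rw [mem_tightEdges] at he ⊢
  rw [load_nextState, h]
  simpa using he

/-- A feasible solution has an edge leaving every demand-active component, and that edge grows. This
keeps `delay` from being the default infimum `0` while something is active. -/
theorem delaySet_nonempty {OPT : Finset (Sym2 V)} (hOPT : I.IsFeasible OPT)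
    (h : I.activeComps σ ≠ ∅) : (I.delaySet σ).Nonempty := by
  obtain ⟨S, hS⟩ := Finset.nonempty_iff_ne_empty.2 h
  obtain ⟨hSc, hSa⟩ := (I.mem_activeComps σ).1 hS
  rcases hSa with ⟨d, hd⟩ | hSb
  · obtain ⟨hd, hcut⟩ := Finset.mem_filter.1 hd
    obtain ⟨a, b, rfl, ha, hb⟩ := hcut.exists_mk
    obtain ⟨e, he⟩ := Joins.exists_cut (hOPT.2 a b hd) ha hb
    obtain ⟨heO, heS⟩ := Finset.mem_filter.1 he
    exact ⟨_, Or.inl ⟨e, hOPT.1 e heO, (I.growthRate_pos σ).2 ⟨S, hS, heS⟩, rfl⟩⟩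
  · exact ⟨_, Or.inr ⟨S, hSc, hSb, rfl⟩⟩

theorem delay_mem {OPT : Finset (Sym2 V)} (hOPT : I.IsFeasible OPT)
    (h : I.activeComps σ ≠ ∅) : I.delay σ ∈ I.delaySet σ :=
  (I.delaySet_nonempty hOPT h).csInf_mem (I.delaySet_finite σ)

theorem delay_pos (hσ : I.IsPacked σ) {OPT : Finset (Sym2 V)} (hOPT : I.IsFeasible OPT)
    (h : I.activeComps σ ≠ ∅) : 0 < I.delay σ :=
  I.delaySet_pos hσ (I.delay_mem hOPT h)

/-- Every component is contained in a component of the next state. -/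
theorem exists_comps_nextState_superset (ε : ℝ) {S : Finset V} (hS : S ∈ I.comps σ) :
    ∃ T ∈ I.comps (I.nextState ε σ), S ⊆ T := by
  obtain ⟨⟨v, hv⟩, hS⟩ := mem_componentSets.1 hS
  obtain ⟨T, hT, hvT⟩ := exists_componentSet (I.tightEdges (I.nextState ε σ)) v
  refine ⟨T, hT, fun w hw => ?_⟩
  rw [(mem_componentSets.1 hT).2 v hvT]
  exact ((hS v hv w).1 hw).mono (I.tightEdges_subset_nextState ε)

theorem card_comps_nextState_le (ε : ℝ) :
    (I.comps (I.nextState ε σ)).card ≤ (I.comps σ).card := by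
  choose! f hf hfs using fun S (hS : S ∈ I.comps σ) => I.exists_comps_nextState_superset ε hS
  refine Finset.card_le_card_of_surjOn f fun T hT => ?_
  obtain ⟨v, hv⟩ := (mem_componentSets.1 hT).1
  obtain ⟨S, hS, hvS⟩ := exists_componentSet (I.tightEdges σ) v
  exact ⟨S, hS, componentSets_eq_of_mem (hf S hS) hT (hfs S hS hvS) hv⟩

/-- If the number of components does not drop, then the components do not change. -/
theorem comps_nextState_eq (ε : ℝ)
    (h : (I.comps σ).card ≤ (I.comps (I.nextState ε σ)).card) :
    I.comps (I.nextState ε σ) = I.comps σ := by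
  choose! f hf hfs using fun S (hS : S ∈ I.comps σ) => I.exists_comps_nextState_superset ε hS
  -- A surjection onto a set that is no smaller is injective, so no two components have merged.
  have hinj : Set.InjOn f (I.comps σ) := by
    refine Finset.injOn_of_surjOn_of_card_le f (t := I.comps (I.nextState ε σ)) hf ?_ h
    intro T hT
    obtain ⟨v, hv⟩ := (mem_componentSets.1 hT).1
    obtain ⟨S, hS, hvS⟩ := exists_componentSet (I.tightEdges σ) v
    exact ⟨S, hS, componentSets_eq_of_mem (hf S hS) hT (hfs S hS hvS) hv⟩
  have hfix : ∀ S ∈ I.comps σ, f S = S := by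
    intro S hS
    refine Finset.Subset.antisymm (fun v hv => ?_) (hfs S hS)
    obtain ⟨S', hS', hvS'⟩ := exists_componentSet (I.tightEdges σ) v
    have : f S' = f S := componentSets_eq_of_mem (hf S' hS') (hf S hS) (hfs S' hS' hvS') hv
    rw [← hinj hS' hS this]
    exact hvS'
  refine (Finset.eq_of_subset_of_card_le (fun S hS => ?_) (I.card_comps_nextState_le ε)).symm
  have := hf S hS
  rwa [hfix S hS] at this

/-- The quantity that decreases with each event. -/
noncomputable def potential (σ : MoatState V) : ℕ :=
  -- Lexicographic order: the factor exceeds any number of active components, so a merger outweighs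
  -- every change in activity.
  (I.comps σ).card * (Fintype.card (Finset V) + 1) + (I.activeComps σ).card

theorem potential_nextState_lt {OPT : Finset (Sym2 V)}
    (hOPT : I.IsFeasible OPT) (ε : ℝ) (h : I.activeComps σ ≠ ∅) :
    I.potential (I.nextState ε σ) < I.potential σ := by
  have hA : (I.activeComps (I.nextState ε σ)).card < Fintype.card (Finset V) + 1 :=
    Nat.lt_succ_of_le (Finset.card_le_univ _)
  rcases lt_or_ge (I.comps (I.nextState ε σ)).card (I.comps σ).card with hlt | hge
  · unfold potential
    have := Nat.mul_le_mul_right (Fintype.card (Finset V) + 1) (Nat.succ_le_of_lt hlt)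
    rw [Nat.succ_mul] at this
    omega
  · have hC := I.comps_nextState_eq ε hge
    have hbud : ∀ S ∈ I.comps σ, (I.nextState ε σ).budget S = I.grownBudget ε σ S := by
      intro S hS
      have : (I.comps σ).filter (fun S' => S' ⊆ S) = {S} := by
        ext S'
        simp only [Finset.mem_filter, Finset.mem_singleton]
        constructor
        · rintro ⟨h1, h2⟩
          obtain ⟨v, hv⟩ := (mem_componentSets.1 h1).1
          exact componentSets_eq_of_mem h1 hS hv (h2 hv)
        · rintro rfl; exact ⟨hS, Finset.Subset.refl _⟩
      simp only [nextState]
      rw [this, Finset.sum_singleton]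
    have hsub : I.activeComps (I.nextState ε σ) ⊆ I.activeComps σ := by
      intro S hS
      rw [mem_activeComps] at hS ⊢
      rw [hC] at hS
      refine ⟨hS.1, ?_⟩
      by_contra hno
      push Not at hno
      rcases hS.2 with h1 | ⟨-, h2⟩
      · exact hno.1 h1
      · rw [hbud S hS.1, grownBudget, if_neg hno.1, if_neg hno.2] at h2
        exact hno.2 ⟨hno.1, h2⟩
    have hss : I.activeComps (I.nextState ε σ) ⊂ I.activeComps σ := by
      refine Finset.ssubset_iff_subset_ne.2 ⟨hsub, fun heq => ?_⟩
      -- The event that determines the delay must deactivate something. An edge becoming tight would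
      -- leave an unchanged component, which is impossible; so some budget reaches zero.
      rcases I.delay_mem hOPT h with ⟨e, he, hpos, hd⟩ | ⟨S, hS, hSb, hd⟩
      · obtain ⟨S, hS, hSe⟩ := (I.growthRate_pos σ).1 hpos
        refine I.not_mem_tightEdges_of_cuts (I.nextState ε σ)
          (hC ▸ I.activeComps_subset σ hS) hSe ?_
        rw [mem_tightEdges, load_nextState, hd]
        have : (0 : ℝ) < I.growthRate σ e := by exact_mod_cast hpos
        refine ⟨he, ?_⟩
        field_simp
        ring
      · have hmem : S ∈ I.activeComps (I.nextState ε σ) :=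
          heq ▸ (I.mem_activeComps σ).2 ⟨hS, Or.inr hSb⟩
        rcases ((I.mem_activeComps _).1 hmem).2 with h1 | ⟨-, h2⟩
        · exact hSb.1 h1
        · rw [hbud S hS, grownBudget, if_neg hSb.1, if_pos hSb, hd] at h2
          simp at h2
    have := Finset.card_lt_card hss
    unfold potential
    rw [hC]
    omega

end Step

/-! ### The run of the algorithm -/

section Run

open scoped Classical

variable (ε : ℝ)

theorem stage_succ (k : ℕ) : I.stage ε (k + 1) = I.nextState ε (I.stage ε k) := by
  rw [stage, Function.iterate_succ_apply']; rfl

theorem isPacked_stage (k : ℕ) : I.IsPacked (I.stage ε k) := by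
  induction k with
  | zero =>
    intro e he
    simpa [stage, load] using I.edgeCost_nonneg e he
  | succ k ih => rw [stage_succ]; exact I.isPacked_nextState ih ε

variable {OPT : Finset (Sym2 V)} (hOPT : I.IsFeasible OPT)
include hOPT

theorem exists_activeComps_eq_empty : ∃ k, I.activeComps (I.stage ε k) = ∅ := by
  by_contra! h
  have key : ∀ k, I.potential (I.stage ε k) + k ≤ I.potential (I.stage ε 0) := by
    intro k
    induction k with
    | zero => simp
    | succ k ih =>
      have := I.potential_nextState_lt hOPT ε (h k).ne_empty
      rw [← stage_succ] at this
      omega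
  have := key (I.potential (I.stage ε 0) + 1)
  omega

theorem activeComps_lastStage : I.activeComps (I.stage ε (I.lastStage ε)) = ∅ :=
  Nat.sInf_mem (s := {k | I.activeComps (I.stage ε k) = ∅}) (I.exists_activeComps_eq_empty ε hOPT)

omit hOPT in
theorem activeComps_ne_empty {k : ℕ} (hk : k < I.lastStage ε) :
    I.activeComps (I.stage ε k) ≠ ∅ :=
  Nat.notMem_of_lt_sInf (s := {k | I.activeComps (I.stage ε k) = ∅}) hk

theorem delay_stage_pos {k : ℕ} (hk : k < I.lastStage ε) : 0 < I.delay (I.stage ε k) :=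
  I.delay_pos (I.isPacked_stage ε k) hOPT (I.activeComps_ne_empty ε hk)

end Run

/-! ### Summation over the stages -/

section Stages

open scoped Classical

variable (ε : ℝ)

/-- The components in stage `k`. -/
noncomputable def stageComps (k : ℕ) : Finset (Finset V) := I.comps (I.stage ε k)

/-- The active components in stage `k`. -/
noncomputable def stageActive (k : ℕ) : Finset (Finset V) := I.activeComps (I.stage ε k)

/-- The duration of stage `k`. -/
noncomputable def stageDelay (k : ℕ) : ℝ := I.delay (I.stage ε k)

theorem stageActive_subset (k : ℕ) : I.stageActive ε k ⊆ I.stageComps ε k :=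
  I.activeComps_subset _

theorem mem_stageActive_of_sep {k : ℕ} {A : Finset V} (hA : A ∈ I.stageComps ε k)
    (h : (I.sep A).Nonempty) : A ∈ I.stageActive ε k :=
  (I.mem_activeComps _).2 ⟨hA, Or.inl h⟩

theorem exists_stageComps (k : ℕ) (v : V) : ∃ S ∈ I.stageComps ε k, v ∈ S :=
  exists_componentSet _ v

theorem stageComps_eq_of_mem {k : ℕ} {A B : Finset V} (hA : A ∈ I.stageComps ε k)
    (hB : B ∈ I.stageComps ε k) {v : V} (hvA : v ∈ A) (hvB : v ∈ B) : A = B :=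
  componentSets_eq_of_mem hA hB hvA hvB

theorem stageComps_disjoint {k : ℕ} {A B : Finset V} (hA : A ∈ I.stageComps ε k)
    (hB : B ∈ I.stageComps ε k) (h : A ≠ B) : Disjoint A B :=
  componentSets_disjoint hA hB h

theorem exists_stageComps_superset {k l : ℕ} (hkl : k ≤ l) {A : Finset V}
    (hA : A ∈ I.stageComps ε k) : ∃ B ∈ I.stageComps ε l, A ⊆ B := by
  induction l, hkl using Nat.le_induction with
  | base => exact ⟨A, hA, Finset.Subset.refl _⟩
  | succ l _ ih =>
    obtain ⟨B, hB, hAB⟩ := ih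
    obtain ⟨B', hB', hBB'⟩ := I.exists_comps_nextState_superset ε hB
    refine ⟨B', ?_, hAB.trans hBB'⟩
    rwa [stageComps, stage_succ]

theorem time_stage (k : ℕ) : (I.stage ε k).time = ∑ i ∈ Finset.range k, I.stageDelay ε i := by
  induction k with
  | zero => simp [stage]
  | succ k ih => rw [Finset.sum_range_succ, ← ih, stage_succ]; rfl

theorem dual_stage (k : ℕ) (U : Finset V) : (I.stage ε k).dual U =
    ∑ i ∈ Finset.range k, if U ∈ I.stageActive ε i then I.stageDelay ε i else 0 := by
  induction k with
  | zero => simp [stage]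
  | succ k ih => rw [Finset.sum_range_succ, ← ih, stage_succ]; rfl

theorem load_stage (k : ℕ) (e : Sym2 V) : load (I.stage ε k) e =
    ∑ i ∈ Finset.range k,
      I.stageDelay ε i * ((I.stageActive ε i).filter fun A => Cuts A e).card := by
  induction k with
  | zero => simp [stage, load]
  | succ k ih =>
    rw [Finset.sum_range_succ, ← ih, stage_succ, load_nextState, mul_comm]; rfl

theorem y_eq (U : Finset V) : I.y ε U =
    ∑ i ∈ Finset.range (I.lastStage ε),
      if U ∈ I.stageActive ε i then I.stageDelay ε i else 0 :=
  I.dual_stage ε _ U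

/-- The dual of `U` is the total duration of the stages in which `U` is active; exchanging the sums
turns dual sums into counts per stage. -/
theorem sum_y_filter (p : Finset V → Prop) [DecidablePred p] :
    ∑ U ∈ Finset.univ.filter p, I.y ε U =
      ∑ k ∈ Finset.range (I.lastStage ε),
        I.stageDelay ε k * ((I.stageActive ε k).filter p).card := by
  simp only [y_eq]
  rw [Finset.sum_comm]
  refine Finset.sum_congr rfl fun k _ => ?_
  rw [← Finset.sum_filter, Finset.sum_const, nsmul_eq_mul, mul_comm]
  congr 3
  ext U
  simp [and_comm]

theorem sum_y_supp_filter (p : Finset V → Prop) [DecidablePred p] :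
    ∑ U ∈ (I.supp ε).filter p, I.y ε U =
      ∑ k ∈ Finset.range (I.lastStage ε),
        I.stageDelay ε k * ((I.stageActive ε k).filter p).card := by
  rw [← sum_y_filter, supp, Finset.filter_filter]
  symm
  refine (Finset.sum_subset (fun U hU => ?_) fun U hU hU' => ?_).symm
  · simp only [Finset.mem_filter, Finset.mem_univ, true_and] at hU ⊢
    exact hU.2
  · simp only [Finset.mem_filter, Finset.mem_univ, true_and] at hU hU'
    by_contra h
    exact hU' ⟨h, hU⟩

theorem sum_y_sepSupp : ∑ U ∈ I.sepSupp ε, I.y ε U =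
      ∑ k ∈ Finset.range (I.lastStage ε),
        I.stageDelay ε k * ((I.stageActive ε k).filter fun A => (I.sep A).Nonempty).card :=
  I.sum_y_supp_filter ε _

theorem coverage_eq (Ps : Finset (Finset (Finset V))) : I.coverage ε Ps =
      ∑ k ∈ Finset.range (I.lastStage ε), I.stageDelay ε k *
        ((I.stageActive ε k).filter fun U => ∃ P ∈ Ps, ∃ A ∈ P, I.sep A = I.sep U).card :=
  I.sum_y_supp_filter ε _

/-- Each separating set is charged to the single pair `φ U`, so summing over the fibres of `φ`
counts it at most once. -/
theorem val_eq {φ : Finset V → Sym2 V} (hφ : I.IsResponsible ε φ) (𝒮 : Finset (Finset V)) :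
    I.val ε φ 𝒮 = ∑ k ∈ Finset.range (I.lastStage ε), I.stageDelay ε k *
        ((I.stageActive ε k).filter fun U => (I.sep U).Nonempty ∧
          ∃ S ∈ 𝒮, Satisfies S (φ U)).card := by
  have h := I.sum_y_supp_filter ε fun U => (I.sep U).Nonempty ∧ ∃ S ∈ 𝒮, Satisfies S (φ U)
  have h2 : (I.supp ε).filter (fun U => (I.sep U).Nonempty ∧ ∃ S ∈ 𝒮, Satisfies S (φ U)) =
      (I.sepSupp ε).filter fun U => ∃ S ∈ 𝒮, Satisfies S (φ U) := by
    ext U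
    simp only [sepSupp, Finset.mem_filter, and_assoc]
  rw [← h, h2, val]
  simp only [demandVal]
  rw [← Finset.sum_fiberwise_of_maps_to (s := (I.sepSupp ε).filter _)
    (t := I.demands.filter (fun d => ∃ S ∈ 𝒮, Satisfies S d)) (g := φ)]
  · refine Finset.sum_congr rfl fun d hd => Finset.sum_congr ?_ fun _ _ => rfl
    ext U
    simp only [Finset.mem_filter] at hd ⊢
    constructor
    · rintro ⟨h1, rfl⟩; exact ⟨⟨h1, hd.2⟩, rfl⟩
    · rintro ⟨⟨h1, -⟩, h2⟩; exact ⟨h1, h2⟩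
  · intro U hU
    simp only [Finset.mem_filter] at hU ⊢
    exact ⟨(Finset.mem_filter.1 (hφ U hU.1)).1, hU.2⟩

theorem mem_supp_of_mem_stageActive {OPT : Finset (Sym2 V)}
    (hOPT : I.IsFeasible OPT) {k : ℕ} (hk : k < I.lastStage ε) {A : Finset V}
    (hA : A ∈ I.stageActive ε k) : A ∈ I.supp ε := by
  refine Finset.mem_filter.2 ⟨Finset.mem_univ _, ne_of_gt ?_⟩
  rw [y_eq]
  refine lt_of_lt_of_le (I.delay_stage_pos ε hOPT hk) ?_
  have := Finset.single_le_sum (s := Finset.range (I.lastStage ε))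
    (f := fun i => if A ∈ I.stageActive ε i then I.stageDelay ε i else 0) (fun i hi => ?_)
    (Finset.mem_range.2 hk)
  · simp only [hA, if_true] at this
    exact this
  · split_ifs
    · exact (I.delay_stage_pos ε hOPT (Finset.mem_range.1 hi)).le
    · exact le_rfl

end Stages

/-! ### Time and stages -/

section Time

open scoped Classical

variable (ε : ℝ)

/-- The first stage in which `v` is not in an active component. -/
noncomputable def deacStage (v : V) : ℕ := sInf {k | ∀ A ∈ I.stageActive ε k, v ∉ A}

/-- The active components of stage `k`, merged along `𝒮`. -/
noncomputable def stageContract (k : ℕ) (𝒮 : Finset (Finset V)) : Finset (Finset V) :=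
  mergeFamily (I.stageActive ε k) fun A B => ∃ S ∈ 𝒮, (A ∩ S).Nonempty ∧ (B ∩ S).Nonempty

theorem exists_active_of_lt_deacStage {v : V} {k : ℕ} (hk : k < I.deacStage ε v) :
    ∃ A ∈ I.stageActive ε k, v ∈ A := by
  have := Nat.notMem_of_lt_sInf hk
  simpa using this

variable {OPT : Finset (Sym2 V)} (hOPT : I.IsFeasible OPT)
include hOPT

theorem not_mem_of_stageActive_deacStage (v : V) :
    ∀ A ∈ I.stageActive ε (I.deacStage ε v), v ∉ A := by
  refine Nat.sInf_mem (s := {k | ∀ A ∈ I.stageActive ε k, v ∉ A}) ⟨I.lastStage ε, ?_⟩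
  intro A hA
  rw [stageActive, I.activeComps_lastStage ε hOPT] at hA
  simp at hA

theorem deacStage_le (v : V) : I.deacStage ε v ≤ I.lastStage ε := by
  refine Nat.sInf_le ?_
  intro A hA
  rw [stageActive, I.activeComps_lastStage ε hOPT] at hA
  simp at hA

theorem time_lt {k l : ℕ} (hkl : k < l) (hl : l ≤ I.lastStage ε) :
    (I.stage ε k).time < (I.stage ε l).time := by
  induction l, hkl using Nat.le_induction with
  | base =>
    rw [time_stage, time_stage, Finset.sum_range_succ]
    exact lt_add_of_pos_right _ (I.delay_stage_pos ε hOPT hl)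
  | succ l _ ih =>
    refine (ih (by omega)).trans ?_
    rw [time_stage, time_stage, Finset.sum_range_succ]
    exact lt_add_of_pos_right _ (I.delay_stage_pos ε hOPT hl)

theorem time_le_iff {k l : ℕ} (hk : k ≤ I.lastStage ε) (hl : l ≤ I.lastStage ε) :
    (I.stage ε k).time ≤ (I.stage ε l).time ↔ k ≤ l := by
  constructor
  · intro h
    by_contra! h'
    exact absurd h (not_le.2 (I.time_lt ε hOPT h' hk))
  · intro h
    rcases h.eq_or_lt with rfl | h
    · exact le_rfl
    · exact (I.time_lt ε hOPT h hl).le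

omit hOPT in
theorem time_zero : (I.stage ε 0).time = 0 := by simp [time_stage]

theorem time_nonneg {k : ℕ} (hk : k ≤ I.lastStage ε) : 0 ≤ (I.stage ε k).time := by
  rw [← I.time_zero ε]
  exact (I.time_le_iff ε hOPT (Nat.zero_le _) hk).2 (Nat.zero_le _)

theorem stageAt_spec {t : ℝ} (ht : 0 ≤ t) :
    I.stageAt ε t ≤ I.lastStage ε ∧ (I.stage ε (I.stageAt ε t)).time ≤ t ∧
      (I.stageAt ε t < I.lastStage ε → t < (I.stage ε (I.stageAt ε t + 1)).time) := by
  have hmem : I.lastStage ε ∈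
      {k : ℕ | t < (I.stage ε (k + 1)).time ∨ I.activeComps (I.stage ε k) = ∅} :=
    Or.inr (I.activeComps_lastStage ε hOPT)
  refine ⟨Nat.sInf_le hmem, ?_, fun hlt => ?_⟩
  · rcases Nat.eq_zero_or_pos (I.stageAt ε t) with h | h
    · rwa [h, time_zero]
    · obtain ⟨j, hj⟩ := Nat.exists_eq_succ_of_ne_zero h.ne'
      have := Nat.notMem_of_lt_sInf (m := j)
        (s := {k : ℕ | t < (I.stage ε (k + 1)).time ∨ I.activeComps (I.stage ε k) = ∅})
        (by change j < I.stageAt ε t; omega)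
      simp only [Set.mem_ofPred_eq, not_or, not_lt] at this
      rw [hj]
      exact this.1
  · have := Nat.sInf_mem ⟨_, hmem⟩
    rcases this with h | h
    · exact h
    · exact absurd h (I.activeComps_ne_empty ε hlt)

theorem stageAt_eq {k : ℕ} {t : ℝ} (hk : k < I.lastStage ε) (h1 : (I.stage ε k).time ≤ t)
    (h2 : t < (I.stage ε (k + 1)).time) : I.stageAt ε t = k := by
  obtain ⟨h3, h4, h5⟩ := I.stageAt_spec ε hOPT ((I.time_nonneg ε hOPT hk.le).trans h1)
  rcases lt_trichotomy (I.stageAt ε t) k with h | h | h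
  · have := (I.time_le_iff ε hOPT (k := I.stageAt ε t + 1) (l := k) (by omega) (by omega)).2 h
    linarith [h5 (by omega)]
  · exact h
  · have := (I.time_le_iff ε hOPT (k := k + 1) (l := I.stageAt ε t) (by omega) (by omega)).2 h
    linarith

theorem stageAt_eq_lastStage {t : ℝ} (h : (I.stage ε (I.lastStage ε)).time ≤ t) :
    I.stageAt ε t = I.lastStage ε := by
  obtain ⟨h3, -, h5⟩ := I.stageAt_spec ε hOPT ((I.time_nonneg ε hOPT le_rfl).trans h)
  by_contra hne
  have hlt : I.stageAt ε t < I.lastStage ε := lt_of_le_of_ne h3 hne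
  have := (I.time_le_iff ε hOPT (k := I.stageAt ε t + 1) hlt le_rfl).2 hlt
  linarith [h5 hlt]

theorem stageAt_time {k : ℕ} (hk : k ≤ I.lastStage ε) :
    I.stageAt ε (I.stage ε k).time = k := by
  rcases hk.eq_or_lt with rfl | h
  · exact I.stageAt_eq_lastStage ε hOPT le_rfl
  · exact I.stageAt_eq ε hOPT h le_rfl (I.time_lt ε hOPT (Nat.lt_succ_self k) h)

/-- The admissible times form a closed interval: at its right end `v` is already inactive, but only
times strictly before `t` are tested. -/
theorem deac_eq (v : V) : I.deac ε v = (I.stage ε (I.deacStage ε v)).time := by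
  have hD := I.deacStage_le ε hOPT v
  have : {t : ℝ | 0 ≤ t ∧ ∀ s, 0 ≤ s → s < t → ∃ S ∈ I.activeAt ε s, v ∈ S} =
      Set.Icc 0 (I.stage ε (I.deacStage ε v)).time := by
    ext t
    simp only [Set.mem_ofPred_eq, Set.mem_Icc]
    refine and_congr_right fun ht => ⟨fun h => ?_, fun h s hs hst => ?_⟩
    · by_contra! hlt
      obtain ⟨A, hA, hvA⟩ := h _ (I.time_nonneg ε hOPT hD) hlt
      rw [activeAt, I.stageAt_time ε hOPT hD] at hA
      exact I.not_mem_of_stageActive_deacStage ε hOPT v A hA hvA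
    · refine I.exists_active_of_lt_deacStage ε (k := I.stageAt ε s) ?_
      obtain ⟨h3, h4, -⟩ := I.stageAt_spec ε hOPT hs
      by_contra! hle
      linarith [(I.time_le_iff ε hOPT hD h3).2 hle]
  rw [deac, this, csSup_Icc (I.time_nonneg ε hOPT hD)]

theorem deac_le_iff (u v : V) : I.deac ε u ≤ I.deac ε v ↔ I.deacStage ε u ≤ I.deacStage ε v := by
  rw [I.deac_eq ε hOPT, I.deac_eq ε hOPT,
    I.time_le_iff ε hOPT (I.deacStage_le ε hOPT u) (I.deacStage_le ε hOPT v)]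

/-- The time bounds are not strict, so the stage that starts at the moment of deactivation still
counts. This matters because the event that deactivates a vertex may be the one that joins it to its
partner. -/
theorem activelyConnected_iff (u v : V) : I.ActivelyConnected ε u v ↔
    ∃ k ≤ I.deacStage ε u, k ≤ I.deacStage ε v ∧ ∃ S ∈ I.stageComps ε k, u ∈ S ∧ v ∈ S := by
  have hu := I.deacStage_le ε hOPT u
  have hv := I.deacStage_le ε hOPT v
  rw [ActivelyConnected, I.deac_eq ε hOPT, I.deac_eq ε hOPT]
  constructor
  · rintro ⟨t, ht, hS, h1, h2⟩
    obtain ⟨h3, h4, -⟩ := I.stageAt_spec ε hOPT ht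
    exact ⟨_, (I.time_le_iff ε hOPT h3 hu).1 (h4.trans h1),
      (I.time_le_iff ε hOPT h3 hv).1 (h4.trans h2), hS⟩
  · rintro ⟨k, h1, h2, hS⟩
    refine ⟨_, I.time_nonneg ε hOPT (h1.trans hu), ?_,
      (I.time_le_iff ε hOPT (h1.trans hu) hu).2 h1, (I.time_le_iff ε hOPT (h1.trans hu) hv).2 h2⟩
    rwa [compsAt, I.stageAt_time ε hOPT (h1.trans hu)]

theorem mem_activeAt_time {k : ℕ} (hk : k < I.lastStage ε) {A : Finset V}
    (hA : A ∈ I.stageActive ε k) : A ∈ I.activeAt ε (I.stage ε k).time := by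
  rwa [activeAt, I.stageAt_time ε hOPT hk.le]

/-- The integrand is a step function, constant on the half-open interval of each stage and zero from
the last stage on. -/
theorem gain_eq (𝒮 : Finset (Finset V)) : I.gain ε 𝒮 =
    ∑ k ∈ Finset.range (I.lastStage ε), I.stageDelay ε k *
      (2 * (((I.stageActive ε k).card : ℝ) - (I.stageContract ε k 𝒮).card)) := by
  set G : ℕ → ℝ := fun k => ((I.stageActive ε k).card : ℝ) - (I.stageContract ε k 𝒮).card with hG
  have hN : G (I.lastStage ε) = 0 := by
    simp [hG, stageContract, stageActive, I.activeComps_lastStage ε hOPT, mergeFamily]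
  have hfun : ∀ t ∈ Set.Ici (0 : ℝ), ((I.activeAt ε t).card : ℝ) -
      ((I.activeContract ε t 𝒮).card : ℝ) = ∑ k ∈ Finset.range (I.lastStage ε),
        (Set.Ico (I.stage ε k).time (I.stage ε (k + 1)).time).indicator (fun _ => G k) t := by
    intro t ht
    obtain ⟨h3, h4, h5⟩ := I.stageAt_spec ε hOPT ht
    change G (I.stageAt ε t) = _
    rcases h3.eq_or_lt with h | h
    · rw [h, hN]
      refine (Finset.sum_eq_zero fun k hk => ?_).symm
      refine Set.indicator_of_notMem (fun hmem => ?_) _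
      have hk := Finset.mem_range.1 hk
      have := I.stageAt_eq ε hOPT hk hmem.1 hmem.2
      omega
    · rw [Finset.sum_eq_single (I.stageAt ε t)]
      · rw [Set.indicator_of_mem]
        exact ⟨h4, h5 h⟩
      · intro k hk hne
        refine Set.indicator_of_notMem (fun hmem => hne ?_) _
        exact (I.stageAt_eq ε hOPT (Finset.mem_range.1 hk) hmem.1 hmem.2).symm
      · intro hk
        exact absurd (Finset.mem_range.2 h) hk
  -- Adding the null point `0` makes the interval of the initial stage a subset of the domain.
  rw [gain, ← MeasureTheory.integral_Ici_eq_integral_Ioi,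
    MeasureTheory.setIntegral_congr_fun measurableSet_Ici hfun,
    MeasureTheory.integral_finsetSum, Finset.mul_sum]
  · refine Finset.sum_congr rfl fun k hk => ?_
    have hk := Finset.mem_range.1 hk
    have h0 := I.time_nonneg ε hOPT hk.le
    rw [MeasureTheory.setIntegral_indicator measurableSet_Ico,
      Set.inter_eq_right.2 (show Set.Ico _ _ ⊆ Set.Ici (0 : ℝ) from fun t ht => h0.trans ht.1),
      MeasureTheory.setIntegral_const,
      MeasureTheory.measureReal_def, Real.volume_Ico, ENNReal.toReal_ofReal]
    · rw [time_stage, time_stage, Finset.sum_range_succ, smul_eq_mul, hG]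
      ring
    · linarith [I.time_lt ε hOPT (Nat.lt_succ_self k) hk]
  · intro k _
    refine MeasureTheory.Integrable.restrict ?_
    refine (MeasureTheory.integrable_indicator_iff measurableSet_Ico).2 ?_
    exact MeasureTheory.integrableOn_const (by simp)

end Time

end SteinerForest

/-! ### Merging a family of sets and counting what remains. -/

section Merge

open scoped Classical

variable {V : Type*} [DecidableEq V] {C : Finset (Finset V)} {r : Finset V → Finset V → Prop}

/-- The members of a family of disjoint sets are merged into a unique set. -/
theorem mergeFamily_eq_of_subset (hC : ∀ A ∈ C, ∀ B ∈ C, ∀ v, v ∈ A → v ∈ B → A = B)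
    {F F' T : Finset V} (hF : F ∈ mergeFamily C r) (hF' : F' ∈ mergeFamily C r) (hT : T ∈ C)
    (hne : T.Nonempty) (h : T ⊆ F) (h' : T ⊆ F') : F = F' := by
  obtain ⟨v, hv⟩ := hne
  have key : ∀ F ∈ mergeFamily C r, T ⊆ F → F = (C.filter fun B =>
      Relation.EqvGen (fun X Y => X ∈ C ∧ Y ∈ C ∧ r X Y) T B).biUnion id := by
    intro F hF h
    obtain ⟨A, hA, rfl⟩ := Finset.mem_image.1 hF
    obtain ⟨B, hB, hvB⟩ := Finset.mem_biUnion.1 (h hv)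
    obtain ⟨hBC, hAB⟩ := Finset.mem_filter.1 hB
    obtain rfl := hC B hBC T hT v hvB hv
    congr 1
    ext X
    simp only [Finset.mem_filter]
    exact and_congr_right fun _ => ⟨fun hX => (hAB.symm _ _).trans _ _ _ hX,
      fun hX => hAB.trans _ _ _ hX⟩
  rw [key F hF h, key F' hF' h']

/-- If every member of `B ⊆ C` meets a member of `𝒮' ⊆ 𝒮`, then merging `C` along `𝒮` leaves at most
`|C| - |B| + |𝒮'|` sets. -/
theorem card_mergeFamily_add_le {𝒮 𝒮' : Finset (Finset V)} (h𝒮 : 𝒮' ⊆ 𝒮) {B : Finset (Finset V)}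
    (hBC : B ⊆ C) (hB : ∀ A ∈ B, ∃ S ∈ 𝒮', (A ∩ S).Nonempty) :
    (mergeFamily C fun A B => ∃ S ∈ 𝒮, (A ∩ S).Nonempty ∧ (B ∩ S).Nonempty).card + B.card
      ≤ C.card + 𝒮'.card := by
  set r : Finset V → Finset V → Prop :=
    fun A B => ∃ S ∈ 𝒮, (A ∩ S).Nonempty ∧ (B ∩ S).Nonempty with hr
  set f : Finset V → Finset V := fun A => (C.filter fun B =>
    Relation.EqvGen (fun X Y => X ∈ C ∧ Y ∈ C ∧ r X Y) A B).biUnion id with hf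
  have hfr : ∀ A ∈ C, ∀ A' ∈ C, r A A' → f A = f A' := by
    intro A hA A' hA' hAA'
    have hE : Relation.EqvGen (fun X Y => X ∈ C ∧ Y ∈ C ∧ r X Y) A A' :=
      Relation.EqvGen.rel _ _ ⟨hA, hA', hAA'⟩
    simp only [hf]
    congr 1
    ext X
    simp only [Finset.mem_filter]
    exact and_congr_right fun _ => ⟨fun hX => (hE.symm _ _).trans _ _ _ hX,
      fun hX => hE.trans _ _ _ hX⟩
  choose! s hs hsA using hB
  -- A merged set comes from a member outside `B`, or it is determined by the set `s A ∈ 𝒮'` met by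
  -- some `A ∈ B`: members with the same `s A` are merged.
  have hsub : mergeFamily C r ⊆ (C \ B).image f ∪ (B.image s).image fun S =>
      if h : ∃ A ∈ B, s A = S then f h.choose else ∅ := by
    intro F hF
    obtain ⟨A, hA, rfl⟩ := Finset.mem_image.1 hF
    by_cases hAB : A ∈ B
    · refine Finset.mem_union_right _ (Finset.mem_image.2
        ⟨s A, Finset.mem_image_of_mem _ hAB, ?_⟩)
      have hex : ∃ A' ∈ B, s A' = s A := ⟨A, hAB, rfl⟩
      rw [dif_pos hex]
      refine hfr _ (hBC hex.choose_spec.1) _ hA ⟨s A, h𝒮 (hs A hAB), ?_, hsA A hAB⟩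
      have := hsA _ hex.choose_spec.1
      rwa [hex.choose_spec.2] at this
    · exact Finset.mem_union_left _ (Finset.mem_image_of_mem _ (Finset.mem_sdiff.2 ⟨hA, hAB⟩))
  have h1 := Finset.card_le_card hsub
  have h2 := Finset.card_union_le ((C \ B).image f) ((B.image s).image fun S =>
      if h : ∃ A ∈ B, s A = S then f h.choose else ∅)
  have h3 : ((C \ B).image f).card ≤ (C \ B).card := Finset.card_image_le
  have h4 : ((B.image s).image fun S =>
      if h : ∃ A ∈ B, s A = S then f h.choose else ∅).card ≤ (B.image s).card :=
    Finset.card_image_le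
  have h5 : (B.image s).card ≤ 𝒮'.card :=
    Finset.card_le_card (Finset.image_subset_iff.2 hs)
  have h6 := Finset.card_sdiff_add_card_eq_card hBC
  omega

end Merge

namespace SteinerForest

variable {V : Type*} [Fintype V] [DecidableEq V] (I : SteinerForest V)

/-! ### The canonical collection -/

section Canonical

open scoped Classical

variable (ε : ℝ)

omit [Fintype V] [DecidableEq V] in
theorem mem_sep {A : Finset V} {d : Sym2 V} : d ∈ I.sep A ↔ d ∈ I.demands ∧ Cuts A d := by
  simp [sep]

theorem mem_canonical {OPT : Finset (Sym2 V)} {r : Finset V → V} {S : Finset V} :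
    S ∈ I.canonical ε OPT r ↔ S.Nonempty ∧ ∃ F ∈ I.forests ε OPT, ∃ T ∈ componentSets OPT, T ⊆ F ∧
      S = T.filter fun v => I.ActivelyConnected ε v (r F) := by
  simp only [canonical, Finset.mem_filter, Finset.mem_biUnion, Finset.mem_image]
  constructor
  · rintro ⟨⟨F, hF, T, ⟨hT, hTF⟩, rfl⟩, hne⟩
    exact ⟨hne, F, hF, T, hT, hTF, rfl⟩
  · rintro ⟨hne, F, hF, T, hT, hTF, rfl⟩
    exact ⟨⟨F, hF, T, ⟨hT, hTF⟩, rfl⟩, hne⟩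

variable {ε} {OPT : Finset (Sym2 V)}

/-- Distinct sets of the canonical collection lie in distinct components of `OPT`. -/
theorem canonical_eq_of_subset {r : Finset V → V} {S S' T : Finset V}
    (hS : S ∈ I.canonical ε OPT r) (hS' : S' ∈ I.canonical ε OPT r)
    (hT : T ∈ componentSets OPT) (h : S ⊆ T) (h' : S' ⊆ T) : S = S' := by
  obtain ⟨⟨v, hv⟩, F, hF, T1, hT1, hTF, rfl⟩ := (I.mem_canonical ε).1 hS
  obtain ⟨⟨v', hv'⟩, F', hF', T2, hT2, hTF', rfl⟩ := (I.mem_canonical ε).1 hS'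
  obtain rfl := componentSets_eq_of_mem hT1 hT (Finset.mem_filter.1 hv).1 (h hv)
  obtain rfl := componentSets_eq_of_mem hT2 hT1 (Finset.mem_filter.1 hv').1 (h' hv')
  have : F = F' := mergeFamily_eq_of_subset
    (fun A hA B hB v hvA hvB => componentSets_eq_of_mem hA hB hvA hvB)
    hF hF' hT (mem_componentSets.1 hT).1 hTF hTF'
  rw [this]

theorem exists_component_of_canonical {r : Finset V → V} {S : Finset V}
    (hS : S ∈ I.canonical ε OPT r) : ∃ T ∈ componentSets OPT, S ⊆ T := by
  obtain ⟨-, F, hF, T, hT, hTF, rfl⟩ := (I.mem_canonical ε).1 hS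
  exact ⟨T, hT, Finset.filter_subset _ _⟩

/-- `u` and `v` lie in a common component in stage `k`. -/
def StageJoined (ε : ℝ) (k : ℕ) (u v : V) : Prop := ∃ A ∈ I.stageComps ε k, u ∈ A ∧ v ∈ A

variable {I}

theorem StageJoined.symm {k : ℕ} {u v : V} (h : I.StageJoined ε k u v) :
    I.StageJoined ε k v u := by
  obtain ⟨A, hA, hu, hv⟩ := h
  exact ⟨A, hA, hv, hu⟩

theorem StageJoined.trans {k : ℕ} {u v w : V} (h : I.StageJoined ε k u v)
    (h' : I.StageJoined ε k v w) : I.StageJoined ε k u w := by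
  obtain ⟨A, hA, hu, hv⟩ := h
  obtain ⟨B, hB, hv', hw⟩ := h'
  obtain rfl := I.stageComps_eq_of_mem ε hA hB hv hv'
  exact ⟨A, hA, hu, hw⟩

theorem StageJoined.mono {k l : ℕ} (hkl : k ≤ l) {u v : V} (h : I.StageJoined ε k u v) :
    I.StageJoined ε l u v := by
  obtain ⟨A, hA, hu, hv⟩ := h
  obtain ⟨B, hB, hAB⟩ := I.exists_stageComps_superset ε hkl hA
  exact ⟨B, hB, hAB hu, hAB hv⟩

theorem StageJoined.mem {k : ℕ} {u v : V} (h : I.StageJoined ε k u v) {A : Finset V}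
    (hA : A ∈ I.stageComps ε k) (hu : u ∈ A) : v ∈ A := by
  obtain ⟨B, hB, hu', hv⟩ := h
  obtain rfl := I.stageComps_eq_of_mem ε hA hB hu hu'
  exact hv

variable (hOPT : I.IsFeasible OPT)
include hOPT

/-- If `u` outlived `v`, the active component of `u` at the deactivation of `v` would contain `v`.
-/
theorem StageJoined.deacStage_le {k : ℕ} {u v : V} (h : I.StageJoined ε k u v)
    (hv : k ≤ I.deacStage ε v) :
    I.deacStage ε u ≤ I.deacStage ε v := by
  by_contra! hlt
  obtain ⟨A, hA, huA⟩ := I.exists_active_of_lt_deacStage ε hlt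
  exact I.not_mem_of_stageActive_deacStage ε hOPT v A hA
    ((h.mono hv).mem (I.stageActive_subset ε _ hA) huA)

theorem activelyConnected_iff_of_le {u v : V} (h : I.deacStage ε u ≤ I.deacStage ε v) :
    I.ActivelyConnected ε u v ↔ I.StageJoined ε (I.deacStage ε u) u v := by
  rw [I.activelyConnected_iff ε hOPT]
  constructor
  · rintro ⟨k, h1, -, hS⟩
    exact StageJoined.mono h1 hS
  · intro hS
    exact ⟨_, le_rfl, h, hS⟩

/-- The ends of a demand pair are deactivated at the same time, when they have been joined. -/
theorem demand_stageJoined {u v : V} (h : s(u, v) ∈ I.demands) : I.StageJoined ε (I.deacStage ε u) u v := by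
  obtain ⟨A, hA, huA⟩ := I.exists_stageComps ε (I.deacStage ε u) u
  by_cases hv : v ∈ A
  · exact ⟨A, hA, huA, hv⟩
  · exact absurd huA (I.not_mem_of_stageActive_deacStage ε hOPT u A
      (I.mem_stageActive_of_sep ε hA ⟨_, I.mem_sep.2 ⟨h, cuts_mk.2 (Or.inl ⟨huA, hv⟩)⟩⟩))

/-- As long as a pair is separated, the component of each end is demand-active; and a pair separated
now was separated in all earlier stages. -/
theorem demand_lt_deacStage {u v : V} (h : s(u, v) ∈ I.demands) {k : ℕ}
    {A : Finset V} (hA : A ∈ I.stageComps ε k) (hu : u ∈ A) (hv : v ∉ A) :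
    k < I.deacStage ε u := by
  by_contra! hle
  have hnj : ¬ I.StageJoined ε (I.deacStage ε u) u v := fun hj => hv ((hj.mono hle).mem hA hu)
  obtain ⟨B, hB, huB⟩ := I.exists_stageComps ε (I.deacStage ε u) u
  refine I.not_mem_of_stageActive_deacStage ε hOPT u B
      (I.mem_stageActive_of_sep ε hB ⟨_, I.mem_sep.2 ⟨h, cuts_mk.2 (Or.inl ⟨huB, ?_⟩)⟩⟩) huB
  exact fun hvB => hnj ⟨B, hB, huB, hvB⟩

variable {r : Finset V → V} (hr : I.IsRootChoice ε OPT r)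
include hr

omit hr in
/-- In any stage, either all of `S` is active, or `S` lies in a single component. -/
theorem canonical_active_or_joined {S : Finset V} (hS : S ∈ I.canonical ε OPT r) (k : ℕ) :
    (∀ v ∈ S, ∃ A ∈ I.stageActive ε k, v ∈ A) ∨ ∃ A ∈ I.stageComps ε k, S ⊆ A := by
  obtain ⟨-, F, hF, T, hT, hTF, rfl⟩ := (I.mem_canonical ε).1 hS
  -- While the root is active, each vertex of `S` is active itself or has already joined the root.
  -- Once the root is deactivated, all of `S` has joined it.
  rcases lt_or_ge k (I.deacStage ε (r F)) with h | h
  · left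
    intro v hv
    rcases lt_or_ge k (I.deacStage ε v) with h' | h'
    · exact I.exists_active_of_lt_deacStage ε h'
    · obtain ⟨l, hl, -, hj⟩ := (I.activelyConnected_iff ε hOPT v (r F)).1 (Finset.mem_filter.1 hv).2
      obtain ⟨A, hA, hrA⟩ := I.exists_active_of_lt_deacStage ε h
      exact ⟨A, hA, (StageJoined.mono (hl.trans h') hj).symm.mem (I.stageActive_subset ε k hA) hrA⟩
  · right
    obtain ⟨A, hA, hrA⟩ := I.exists_stageComps ε k (r F)
    refine ⟨A, hA, fun v hv => ?_⟩
    obtain ⟨l, -, hl, hj⟩ := (I.activelyConnected_iff ε hOPT v (r F)).1 (Finset.mem_filter.1 hv).2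
    exact (StageJoined.mono (hl.trans h) hj).symm.mem hA hrA

/-- A set of the canonical collection that touches a component `A` contains every demand pair of its
component of `OPT` that is separated by `A`. -/
theorem canonical_closed {S T A : Finset V} (hS : S ∈ I.canonical ε OPT r)
    (hT : T ∈ componentSets OPT) (hST : S ⊆ T) {k : ℕ} (hA : A ∈ I.stageComps ε k)
    (hAS : (A ∩ S).Nonempty) {d : Sym2 V} (hd : d ∈ I.sep A) (hdT : Satisfies T d) :
    Satisfies S d := by
  obtain ⟨⟨v, hv⟩, F, hF, T', hT', hTF, rfl⟩ := (I.mem_canonical ε).1 hS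
  obtain rfl := componentSets_eq_of_mem hT' hT (Finset.mem_filter.1 hv).1 (hST hv)
  have hmax : ∀ v ∈ T', I.deacStage ε v ≤ I.deacStage ε (r F) := fun v hv =>
    (I.deac_le_iff ε hOPT _ _).1 ((hr F hF).2 v (hTF hv))
  obtain ⟨hdD, hcut⟩ := I.mem_sep.1 hd
  obtain ⟨a, b, rfl, ha, hb⟩ := hcut.exists_mk
  have haT : a ∈ T' := hdT a (Sym2.mem_mk_left a b)
  have hbT : b ∈ T' := hdT b (Sym2.mem_mk_right a b)
  have hka := demand_lt_deacStage hOPT hdD hA ha hb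
  -- Let `w ∈ S` share the component `A` with `a`. If `w` has not been deactivated before stage `k`,
  -- then `a` and `w` are deactivated together, and `w` reaches the root by then; otherwise `w`
  -- reached it before stage `k`.
  have hra : I.StageJoined ε (I.deacStage ε a) a (r F) := by
    obtain ⟨w, hw⟩ := hAS
    obtain ⟨hwA, hwS⟩ := Finset.mem_inter.1 hw
    obtain ⟨hwT, hwr⟩ := Finset.mem_filter.1 hwS
    rw [activelyConnected_iff_of_le hOPT (hmax w hwT)] at hwr
    have haw : I.StageJoined ε k a w := ⟨A, hA, ha, hwA⟩
    rcases le_or_gt k (I.deacStage ε w) with h | h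
    · have h1 := haw.deacStage_le hOPT h
      have h2 := haw.symm.deacStage_le hOPT hka.le
      have h3 : I.deacStage ε w = I.deacStage ε a := le_antisymm h2 h1
      rw [h3] at hwr
      exact (haw.mono hka.le).trans hwr
    · exact (haw.trans (hwr.mono h.le)).mono hka.le
  -- The end deactivated first has joined its partner by then, so the connection to the root passes
  -- from `a` to `b`.
  have hrb : I.StageJoined ε (I.deacStage ε b) b (r F) := by
    rcases le_total (I.deacStage ε a) (I.deacStage ε b) with h | h
    · have hab : I.StageJoined ε _ a b := demand_stageJoined hOPT hdD
      exact (hab.symm.trans hra).mono h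
    · have hba : I.StageJoined ε _ b a := demand_stageJoined hOPT (by rwa [Sym2.eq_swap] at hdD)
      have h1 := hba.deacStage_le hOPT h
      have h2 : I.deacStage ε a = I.deacStage ε b := le_antisymm
        (hba.symm.deacStage_le hOPT le_rfl) h1
      rw [h2] at hra
      exact hba.trans hra
  intro x hx
  rcases Sym2.mem_iff.1 hx with rfl | rfl
  · exact Finset.mem_filter.2 ⟨haT, (activelyConnected_iff_of_le hOPT (hmax _ haT)).2 hra⟩
  · exact Finset.mem_filter.2 ⟨hbT, (activelyConnected_iff_of_le hOPT (hmax _ hbT)).2 hrb⟩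

/-- The properties of the canonical collection that the estimates use. -/
structure _root_.SteinerForest.IsAligned {V : Type*} [Fintype V] [DecidableEq V]
    (I : SteinerForest V) (ε : ℝ) (OPT : Finset (Sym2 V)) (𝒮 : Finset (Finset V)) : Prop where
  exists_component : ∀ S ∈ 𝒮, ∃ T ∈ componentSets OPT, S ⊆ T
  eq_of_subset : ∀ S ∈ 𝒮, ∀ S' ∈ 𝒮, ∀ T ∈ componentSets OPT, S ⊆ T → S' ⊆ T → S = S'
  active_or_joined : ∀ S ∈ 𝒮, ∀ k,
    (∀ v ∈ S, ∃ A ∈ I.stageActive ε k, v ∈ A) ∨ ∃ A ∈ I.stageComps ε k, S ⊆ A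
  closed : ∀ S ∈ 𝒮, ∀ T ∈ componentSets OPT, S ⊆ T → ∀ k, ∀ A ∈ I.stageComps ε k,
    (A ∩ S).Nonempty → ∀ d ∈ I.sep A, Satisfies T d → Satisfies S d

theorem canonical_isAligned : I.IsAligned ε OPT (I.canonical ε OPT r) where
  exists_component _ hS := I.exists_component_of_canonical hS
  eq_of_subset _ hS _ hS' _ hT h h' := I.canonical_eq_of_subset hS hS' hT h h'
  active_or_joined _ hS k := canonical_active_or_joined hOPT hS k
  closed _ hS _ hT hST _ _ hA hAS _ hd hdT := canonical_closed hOPT hr hS hT hST hA hAS hd hdT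

end Canonical

/-! ### Estimates for a single stage -/

section Stage

open scoped Classical

variable (ε : ℝ) (OPT : Finset (Sym2 V))

/-- The number of edges of `OPT` in `δ(A)` that are not needed to separate a demand pair. -/
noncomputable def surplus (A : Finset V) : ℕ :=
  (cutEdges OPT A).card - if (I.sep A).Nonempty then 1 else 0

/-- The active components of stage `k` that meet `S`. -/
noncomputable def touching (k : ℕ) (S : Finset V) : Finset (Finset V) :=
  (I.stageActive ε k).filter fun A => (A ∩ S).Nonempty

/-- The sets of `𝒮` that meet at least two active components of stage `k`. -/
noncomputable def spread (k : ℕ) (𝒮 : Finset (Finset V)) : Finset (Finset V) :=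
  𝒮.filter fun S => 2 ≤ (I.touching ε k S).card

/-- The number of sets in `spread` that meet `A`. -/
noncomputable def multiplicity (k : ℕ) (𝒮 : Finset (Finset V)) (A : Finset V) : ℕ :=
  ((I.spread ε k 𝒮).filter fun S => (A ∩ S).Nonempty).card

/-- All active components that meet `S` in stage `k` have no surplus. -/
def Clean (k : ℕ) (S : Finset V) : Prop := ∀ A ∈ I.touching ε k S, I.surplus OPT A = 0

variable {ε OPT}

theorem mem_touching {k : ℕ} {S A : Finset V} :
    A ∈ I.touching ε k S ↔ A ∈ I.stageActive ε k ∧ (A ∩ S).Nonempty := by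
  simp [touching]

theorem card_cutEdges_pos (hOPT : I.IsFeasible OPT) {A : Finset V} (h : (I.sep A).Nonempty) :
    0 < (cutEdges OPT A).card := by
  obtain ⟨d, hd⟩ := h
  obtain ⟨hdD, hcut⟩ := I.mem_sep.1 hd
  obtain ⟨a, b, rfl, ha, hb⟩ := hcut.exists_mk
  exact Finset.card_pos.2 (Joins.exists_cut (hOPT.2 a b hdD) ha hb)

theorem card_cutEdges_eq (hOPT : I.IsFeasible OPT) (A : Finset V) :
    (cutEdges OPT A).card = I.surplus OPT A + if (I.sep A).Nonempty then 1 else 0 := by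
  rw [surplus]
  split_ifs with h
  · have := I.card_cutEdges_pos hOPT h
    omega
  · omega

/-- A set that cuts only one edge of `OPT` separates only demand pairs of one component. -/
theorem satisfies_of_card_cutEdges_eq_one (hOPT : I.IsFeasible OPT) {A T : Finset V}
    (hT : T ∈ componentSets OPT) (h : (cutEdges OPT A).card ≤ 1) {u v : V} (hu : u ∈ T)
    (hv : v ∈ T) (huA : u ∈ A) (hvA : v ∉ A) {d : Sym2 V} (hd : d ∈ I.sep A) :
    Satisfies T d := by
  obtain ⟨hdD, hcut⟩ := I.mem_sep.1 hd
  obtain ⟨a, b, rfl, ha, hb⟩ := hcut.exists_mk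
  obtain ⟨T', hT', haT'⟩ := exists_componentSet OPT a
  have hbT' : b ∈ T' := ((mem_componentSets.1 hT').2 a haT' b).2 (hOPT.2 a b hdD)
  obtain ⟨e, he⟩ := (joins_filter_satisfies hT hu hv).exists_cut huA hvA
  obtain ⟨e', he'⟩ := (joins_filter_satisfies hT' haT' hbT').exists_cut ha hb
  simp only [cutEdges, Finset.mem_filter] at he he'
  -- The only edge of OPT crossing `A` lies both in `T` and in the component of the pair, so these
  -- coincide.
  have hee : e = e' := Finset.card_le_one.1 h e (Finset.mem_filter.2 ⟨he.1.1, he.2⟩) e'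
    (Finset.mem_filter.2 ⟨he'.1.1, he'.2⟩)
  subst hee
  obtain ⟨x, hx, -⟩ := he.2.1
  obtain rfl := componentSets_eq_of_mem hT hT' (he.1.2 x hx) (he'.1.2 x hx)
  intro y hy
  rcases Sym2.mem_iff.1 hy with rfl | rfl <;> assumption

/-- An assignment of edge sets to the members of `𝒮`, each inside the right component of `OPT`. -/
def IsLocalSystem (OPT : Finset (Sym2 V)) (𝒮 : Finset (Finset V))
    (X : Finset V → Finset (Sym2 V)) : Prop :=
  ∀ S ∈ 𝒮, ∃ T ∈ componentSets OPT, S ⊆ T ∧ X S ⊆ OPT.filter fun e => Satisfies T e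

/-- The edge sets of a local system are disjoint. -/
theorem IsLocalSystem.sum_le {𝒮 : Finset (Finset V)} (h𝒮 : I.IsAligned ε OPT 𝒮)
    {X : Finset V → Finset (Sym2 V)} (hX : IsLocalSystem OPT 𝒮 X) {f : Sym2 V → ℝ}
    (hf : ∀ e ∈ OPT, 0 ≤ f e) : ∑ S ∈ 𝒮, ∑ e ∈ X S, f e ≤ ∑ e ∈ OPT, f e := by
  rw [← Finset.sum_biUnion]
  · refine Finset.sum_le_sum_of_subset_of_nonneg (fun e he => ?_) fun e he _ => hf e he
    obtain ⟨S, hS, heS⟩ := Finset.mem_biUnion.1 he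
    obtain ⟨T, -, -, hXT⟩ := hX S hS
    exact (Finset.mem_filter.1 (hXT heS)).1
  · intro S hS S' hS' hne
    refine Finset.disjoint_left.2 fun e he he' => hne ?_
    obtain ⟨T, hT, hST, hXT⟩ := hX S hS
    obtain ⟨T', hT', hST', hXT'⟩ := hX S' hS'
    have h1 := (Finset.mem_filter.1 (hXT he)).2
    have h2 := (Finset.mem_filter.1 (hXT' he')).2
    induction e with
    | h a b =>
      obtain rfl := componentSets_eq_of_mem hT hT' (h1 a (Sym2.mem_mk_left a b))
        (h2 a (Sym2.mem_mk_left a b))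
      exact h𝒮.eq_of_subset S hS S' hS' T hT hST hST'

theorem IsLocalSystem.sum_card_cutEdges_le {𝒮 : Finset (Finset V)} (h𝒮 : I.IsAligned ε OPT 𝒮)
    {X : Finset V → Finset (Sym2 V)} (hX : IsLocalSystem OPT 𝒮 X) (A : Finset V) :
    ∑ S ∈ 𝒮, (cutEdges (X S) A).card ≤ (cutEdges OPT A).card := by
  have h := hX.sum_le I h𝒮 (f := fun e => if Cuts A e then 1 else 0)
    (fun e _ => by split_ifs <;> norm_num)
  simp only [← Finset.sum_filter, Finset.sum_const, nsmul_eq_mul, mul_one] at h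
  exact_mod_cast h

theorem touching_disjoint {k : ℕ} {A B : Finset V} (hA : A ∈ I.stageActive ε k)
    (hB : B ∈ I.stageActive ε k) (h : A ≠ B) : Disjoint A B :=
  I.stageComps_disjoint ε (I.stageActive_subset ε k hA) (I.stageActive_subset ε k hB) h

variable {𝒮 : Finset (Finset V)}

theorem subset_of_card_touching_lt (h𝒮 : I.IsAligned ε OPT 𝒮) {S A : Finset V} (hS : S ∈ 𝒮)
    {k : ℕ} (h : (I.touching ε k S).card < 2) (hA : A ∈ I.stageActive ε k)
    (hAS : (A ∩ S).Nonempty) : S ⊆ A := by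
  rcases h𝒮.active_or_joined S hS k with h1 | ⟨B, hB, hSB⟩
  · intro v hv
    obtain ⟨B, hB, hvB⟩ := h1 v hv
    have : A = B := Finset.card_le_one.1 (Nat.le_of_lt_succ h) A (I.mem_touching.2 ⟨hA, hAS⟩) B
      (I.mem_touching.2 ⟨hB, ⟨v, Finset.mem_inter.2 ⟨hvB, hv⟩⟩⟩)
    rwa [this]
  · obtain ⟨v, hv⟩ := hAS
    rw [Finset.mem_inter] at hv
    obtain rfl := I.stageComps_eq_of_mem ε (I.stageActive_subset ε k hA) hB hv.1 (hSB hv.2)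
    exact hSB

/-- With two touched components, `S` cannot lie in one component, so all its vertices are active.
Hence the touched components partition `S`. -/
theorem subset_biUnion_touching (h𝒮 : I.IsAligned ε OPT 𝒮) {S : Finset V} (hS : S ∈ 𝒮)
    {k : ℕ} (h : 2 ≤ (I.touching ε k S).card) {v : V} (hv : v ∈ S) :
    ∃ A ∈ I.touching ε k S, v ∈ A := by
  rcases h𝒮.active_or_joined S hS k with h1 | ⟨B, hB, hSB⟩
  · obtain ⟨A, hA, hvA⟩ := h1 v hv
    exact ⟨A, I.mem_touching.2 ⟨hA, ⟨v, Finset.mem_inter.2 ⟨hvA, hv⟩⟩⟩, hvA⟩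
  · exfalso
    have : (I.touching ε k S).card ≤ 1 := by
      refine Finset.card_le_one.2 fun A hA A' hA' => ?_
      rw [mem_touching] at hA hA'
      obtain ⟨⟨hA, a, ha⟩, hA', a', ha'⟩ := And.intro hA hA'
      rw [Finset.mem_inter] at ha ha'
      exact (I.stageComps_eq_of_mem ε (I.stageActive_subset ε k hA) hB ha.1 (hSB ha.2)).trans
        (I.stageComps_eq_of_mem ε (I.stageActive_subset ε k hA') hB ha'.1 (hSB ha'.2)).symm
    omega

theorem exists_not_mem_of_touching {S A : Finset V} {k : ℕ}
    (h : 2 ≤ (I.touching ε k S).card) (hA : A ∈ I.stageActive ε k) : ∃ v ∈ S, v ∉ A := by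
  obtain ⟨B, hB, hne⟩ := Finset.exists_mem_ne (by omega : 1 < (I.touching ε k S).card) A
  obtain ⟨hB, v, hv⟩ := I.mem_touching.1 hB
  rw [Finset.mem_inter] at hv
  exact ⟨v, hv.2, Finset.disjoint_left.1 (I.touching_disjoint hB hA hne) hv.1⟩

/-- `X` connects `R`, and never crosses in a single edge a set that does not separate `R`. -/
structure _root_.IsConnector {V : Type*} (X : Finset (Sym2 V)) (R : Finset V) : Prop where
  joins : ∀ u ∈ R, ∀ v ∈ R, Joins X u v
  card_ne_one : ∀ A : Finset V, (Disjoint R A ∨ R ⊆ A) → (cutEdges X A).card ≠ 1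

theorem exists_connector_system (h𝒮 : I.IsAligned ε OPT 𝒮) (R : Finset V → Finset V)
    (hR : ∀ S ∈ 𝒮, R S ⊆ S) :
    ∃ X : Finset V → Finset (Sym2 V), IsLocalSystem OPT 𝒮 X ∧
      ∀ S ∈ 𝒮, IsConnector (X S) (R S) := by
  have : ∀ S ∈ 𝒮, ∃ X : Finset (Sym2 V), (∃ T ∈ componentSets OPT, S ⊆ T ∧
      X ⊆ OPT.filter fun e => Satisfies T e) ∧ IsConnector X (R S) := by
    intro S hS
    obtain ⟨T, hT, hST⟩ := h𝒮.exists_component S hS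
    obtain ⟨X, hX, h1, h2⟩ := exists_minimal_connector (OPT.filter fun e => Satisfies T e) (R S)
      fun u hu v hv => joins_filter_satisfies hT (hST (hR S hS hu)) (hST (hR S hS hv))
    exact ⟨X, ⟨T, hT, hST, hX⟩, ⟨h1, h2⟩⟩
  choose! X h1 h2 using this
  exact ⟨X, h1, h2⟩

/-- Outside the excluded case `A` does not split `R`: it misses `R`, or `S` is not spread and lies
entirely in `A`. -/
theorem card_cutEdges_ne_one (h𝒮 : I.IsAligned ε OPT 𝒮) {S R A : Finset V} (hS : S ∈ 𝒮)
    (hRS : R ⊆ S) {X : Finset (Sym2 V)} (hX : IsConnector X R) {k : ℕ}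
    (hA : A ∈ I.stageActive ε k) (h : ¬ (S ∈ I.spread ε k 𝒮 ∧ (A ∩ R).Nonempty)) :
    (cutEdges X A).card ≠ 1 := by
  refine hX.card_ne_one A ?_
  by_cases hAR : (A ∩ R).Nonempty
  · right
    have : (I.touching ε k S).card < 2 := by
      by_contra! h2
      exact h ⟨Finset.mem_filter.2 ⟨hS, h2⟩, hAR⟩
    exact hRS.trans (I.subset_of_card_touching_lt h𝒮 hS this hA
      (hAR.mono (Finset.inter_subset_inter_left hRS)))
  · left
    rw [Finset.not_nonempty_iff_eq_empty, ← Finset.disjoint_iff_inter_eq_empty] at hAR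
    exact hAR.symm

theorem card_cutEdges_pos_of_spread {S A : Finset V}
    {X : Finset (Sym2 V)} (hX : IsConnector X S) {k : ℕ} (hA : A ∈ I.stageActive ε k)
    (hS : S ∈ I.spread ε k 𝒮) (hAS : (A ∩ S).Nonempty) : 0 < (cutEdges X A).card := by
  obtain ⟨v, hv, hvA⟩ := I.exists_not_mem_of_touching (Finset.mem_filter.1 hS).2 hA
  obtain ⟨u, hu⟩ := hAS
  rw [Finset.mem_inter] at hu
  exact Finset.card_pos.2 ((hX.joins u hu.2 v hv).exists_cut hu.1 hvA)

theorem multiplicity_le {X : Finset V → Finset (Sym2 V)}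
    (hXc : ∀ S ∈ 𝒮, IsConnector (X S) S) {k : ℕ} {A : Finset V} (hA : A ∈ I.stageActive ε k) :
    I.multiplicity ε k 𝒮 A ≤ ∑ S ∈ 𝒮, (cutEdges (X S) A).card := by
  rw [multiplicity, Finset.card_eq_sum_ones]
  refine (Finset.sum_le_sum (g := fun S => (cutEdges (X S) A).card) fun S hS => ?_).trans
    (Finset.sum_le_sum_of_subset ((Finset.filter_subset _ _).trans (Finset.filter_subset _ _)))
  obtain ⟨h1, h2⟩ := Finset.mem_filter.1 hS
  exact I.card_cutEdges_pos_of_spread (hXc S (Finset.mem_filter.1 h1).1) hA h1 h2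

/-- The balance of a single active component. -/
theorem sum_card_cutEdges_add_multiplicity_le (hOPT : I.IsFeasible OPT)
    (h𝒮 : I.IsAligned ε OPT 𝒮)
    {X : Finset V → Finset (Sym2 V)} (hX : IsLocalSystem OPT 𝒮 X)
    (hXc : ∀ S ∈ 𝒮, IsConnector (X S) S) {k : ℕ} {A : Finset V} (hA : A ∈ I.stageActive ε k) :
    ∑ S ∈ 𝒮, (cutEdges (X S) A).card + I.multiplicity ε k 𝒮 A ≤
      2 * I.surplus OPT A + 2 * if 0 < I.multiplicity ε k 𝒮 A then 1 else 0 := by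
  have h1 := hX.sum_card_cutEdges_le I h𝒮 A
  have h2 := I.card_cutEdges_eq hOPT A
  have h3 := I.multiplicity_le hXc hA
  have h4 : (if (I.sep A).Nonempty then 1 else 0) ≤ 1 := by split_ifs <;> omega
  -- If some spread set meets `A`, both terms on the left are at most the surplus plus one. If none
  -- does, no connector crosses `A` exactly once, so there are no crossings or at least two; in the
  -- latter case the surplus is positive and twice it suffices.
  split_ifs with hm
  · omega
  · have hm0 : I.multiplicity ε k 𝒮 A = 0 := by omega
    rw [hm0]
    by_cases hsum : ∑ S ∈ 𝒮, (cutEdges (X S) A).card ≤ 1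
    · have : ∑ S ∈ 𝒮, (cutEdges (X S) A).card = 0 := by
        refine Finset.sum_eq_zero fun S hS => ?_
        have h5 := Finset.single_le_sum (f := fun S => (cutEdges (X S) A).card)
          (fun _ _ => Nat.zero_le _) hS
        have h6 := I.card_cutEdges_ne_one h𝒮 hS (Finset.Subset.refl S) (hXc S hS) hA
          fun ⟨h7, h8⟩ => by
            have : 0 < I.multiplicity ε k 𝒮 A :=
              Finset.card_pos.2 ⟨S, Finset.mem_filter.2 ⟨h7, h8⟩⟩
            omega
        omega
      omega
    · omega

/-- The spread sets meeting `A` have edge-disjoint connectors in OPT, each leaving `A`, and the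
surplus omits at most one edge of the cut. -/
theorem multiplicity_le_surplus (hOPT : I.IsFeasible OPT) (h𝒮 : I.IsAligned ε OPT 𝒮) {k : ℕ}
    {A : Finset V} (hA : A ∈ I.stageActive ε k) :
    I.multiplicity ε k 𝒮 A ≤ I.surplus OPT A + 1 := by
  obtain ⟨X, hX, hXc⟩ := I.exists_connector_system h𝒮 id fun S _ => Finset.Subset.refl S
  have h1 := hX.sum_card_cutEdges_le I h𝒮 A
  have h2 := I.card_cutEdges_eq hOPT A
  have h3 := I.multiplicity_le hXc hA
  have h4 : (if (I.sep A).Nonempty then 1 else 0) ≤ 1 := by split_ifs <;> omega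
  omega

theorem sum_multiplicity (k : ℕ) (𝒮 : Finset (Finset V)) :
    ∑ A ∈ I.stageActive ε k, I.multiplicity ε k 𝒮 A =
      ∑ S ∈ I.spread ε k 𝒮, (I.touching ε k S).card := by
  simp only [multiplicity, touching, Finset.card_eq_sum_ones, Finset.sum_filter]
  exact Finset.sum_comm

/-- The gain of a stage, compared to the cost. -/
theorem stage_gain (hOPT : I.IsFeasible OPT) (h𝒮 : I.IsAligned ε OPT 𝒮)
    {X : Finset V → Finset (Sym2 V)} (hX : IsLocalSystem OPT 𝒮 X)
    (hXc : ∀ S ∈ 𝒮, IsConnector (X S) S) (k : ℕ) :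
    ∑ A ∈ I.stageActive ε k, ∑ S ∈ 𝒮, (cutEdges (X S) A).card +
      ∑ S ∈ I.spread ε k 𝒮, (I.touching ε k S).card + 2 * (I.stageContract ε k 𝒮).card ≤
    2 * ∑ A ∈ I.stageActive ε k, I.surplus OPT A + 2 * (I.stageActive ε k).card +
      2 * (I.spread ε k 𝒮).card := by
  have h1 := Finset.sum_le_sum fun A hA =>
    I.sum_card_cutEdges_add_multiplicity_le (k := k) hOPT h𝒮 hX hXc (A := A) hA
  rw [Finset.sum_add_distrib, Finset.sum_add_distrib, sum_multiplicity, ← Finset.mul_sum,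
    ← Finset.mul_sum, ← Finset.sum_filter, ← Finset.card_eq_sum_ones] at h1
  have h2 := card_mergeFamily_add_le (C := I.stageActive ε k) (𝒮 := 𝒮) (𝒮' := I.spread ε k 𝒮)
    (Finset.filter_subset _ _)
    (B := (I.stageActive ε k).filter fun A => 0 < I.multiplicity ε k 𝒮 A)
    (Finset.filter_subset _ _) (fun A hA => by
      obtain ⟨S, hS⟩ := Finset.card_pos.1 (Finset.mem_filter.1 hA).2
      exact ⟨S, Finset.mem_filter.1 hS⟩)
  change (I.stageContract ε k 𝒮).card + _ ≤ _ at h2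
  omega

/-- The value collected in a stage. -/
theorem stage_val {φ : Finset V → Sym2 V} (hOPT : I.IsFeasible OPT)
    (hφ : I.IsResponsible ε φ) {k : ℕ} (hk : k < I.lastStage ε) :
    ((I.stageActive ε k).filter fun U => (I.sep U).Nonempty ∧
        ∃ S ∈ 𝒮, Satisfies S (φ U)).card ≤ ∑ S ∈ I.spread ε k 𝒮, (I.touching ε k S).card := by
  rw [← sum_multiplicity, Finset.card_eq_sum_ones, Finset.sum_filter]
  refine Finset.sum_le_sum fun A hA => ?_
  split_ifs with h
  · obtain ⟨hsep, S, hS, hSφ⟩ := h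
    have hmem : A ∈ I.sepSupp ε :=
      Finset.mem_filter.2 ⟨I.mem_supp_of_mem_stageActive ε hOPT hk hA, hsep⟩
    obtain ⟨hd, hcut⟩ := I.mem_sep.1 (hφ A hmem)
    obtain ⟨a, b, hab, ha, hb⟩ := hcut.exists_mk
    rw [hab] at hSφ hd
    have haS := hSφ a (Sym2.mem_mk_left a b)
    have hbS := hSφ b (Sym2.mem_mk_right a b)
    -- The component of the other end also separates `φ A`, so it is active and `S` touches two
    -- active components.
    obtain ⟨B, hB, hbB⟩ := I.exists_stageComps ε k b
    have hAc := I.stageActive_subset ε k hA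
    have haB : a ∉ B := fun haB => hb (I.stageComps_eq_of_mem ε hAc hB ha haB ▸ hbB)
    have hBa : B ∈ I.stageActive ε k :=
      I.mem_stageActive_of_sep ε hB ⟨_, I.mem_sep.2 ⟨hd, cuts_mk.2 (Or.inr ⟨hbB, haB⟩)⟩⟩
    have hA' : A ∈ I.touching ε k S :=
      I.mem_touching.2 ⟨hA, a, Finset.mem_inter.2 ⟨ha, haS⟩⟩
    have hB' : B ∈ I.touching ε k S :=
      I.mem_touching.2 ⟨hBa, b, Finset.mem_inter.2 ⟨hbB, hbS⟩⟩
    refine Finset.card_pos.2 ⟨S, Finset.mem_filter.2 ⟨Finset.mem_filter.2 ⟨hS, ?_⟩,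
      (I.mem_touching.1 hA').2⟩⟩
    exact Finset.one_lt_card.2 ⟨A, hA', B, hB', fun h => hb (h ▸ hbB)⟩
  · exact Nat.zero_le _

/-- The number of sets of `𝒮` that are not clean in stage `k`. -/
theorem stage_not_clean (hOPT : I.IsFeasible OPT) (h𝒮 : I.IsAligned ε OPT 𝒮) (k : ℕ) :
    ((I.spread ε k 𝒮).filter fun S => ¬ I.Clean ε OPT k S).card ≤
      2 * ∑ A ∈ I.stageActive ε k, I.surplus OPT A := by
  have h1 : ((I.spread ε k 𝒮).filter fun S => ¬ I.Clean ε OPT k S) ⊆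
      ((I.stageActive ε k).filter fun A => 0 < I.surplus OPT A).biUnion fun A =>
        (I.spread ε k 𝒮).filter fun S => (A ∩ S).Nonempty := by
    intro S hS
    obtain ⟨hS, hcl⟩ := Finset.mem_filter.1 hS
    simp only [Clean, not_forall] at hcl
    obtain ⟨A, hA, hx⟩ := hcl
    obtain ⟨hA, hAS⟩ := I.mem_touching.1 hA
    exact Finset.mem_biUnion.2 ⟨A, Finset.mem_filter.2 ⟨hA, Nat.pos_of_ne_zero hx⟩,
      Finset.mem_filter.2 ⟨hS, hAS⟩⟩
  refine (Finset.card_le_card h1).trans (Finset.card_biUnion_le.trans ?_)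
  rw [Finset.sum_filter, Finset.mul_sum]
  refine Finset.sum_le_sum fun A hA => ?_
  -- A component with positive surplus spoils at most surplus plus one sets, hence at most twice its
  -- surplus.
  have := I.multiplicity_le_surplus hOPT h𝒮 hA
  rw [multiplicity] at this
  split_ifs <;> omega

/-- The cost of connectors for subsets `R S` of the sets of `𝒮`, in a single stage. -/
theorem stage_connectors (hOPT : I.IsFeasible OPT) (h𝒮 : I.IsAligned ε OPT 𝒮)
    {R : Finset V → Finset V} (hR : ∀ S ∈ 𝒮, R S ⊆ S)
    {X : Finset V → Finset (Sym2 V)} (hX : IsLocalSystem OPT 𝒮 X)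
    (hXc : ∀ S ∈ 𝒮, IsConnector (X S) (R S)) (k : ℕ) :
    ∑ A ∈ I.stageActive ε k, ∑ S ∈ 𝒮, (cutEdges (X S) A).card ≤
      2 * ∑ A ∈ I.stageActive ε k, I.surplus OPT A +
        ∑ S ∈ I.spread ε k 𝒮, min (R S).card (I.touching ε k S).card := by
  have key : ∀ A ∈ I.stageActive ε k, ∑ S ∈ 𝒮, (cutEdges (X S) A).card ≤
      2 * I.surplus OPT A + ∑ S ∈ I.spread ε k 𝒮, if (A ∩ R S).Nonempty then 1 else 0 := by
    intro A hA
    have h1 := hX.sum_card_cutEdges_le I h𝒮 A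
    have h2 := I.card_cutEdges_eq hOPT A
    have h4 : (if (I.sep A).Nonempty then 1 else 0) ≤ 1 := by split_ifs <;> omega
    -- Without surplus at most one edge crosses `A`, and it belongs to a spread set whose `R S`
    -- meets `A`. With surplus, the whole cut is at most twice the surplus.
    rcases Nat.eq_zero_or_pos (I.surplus OPT A) with h | h
    · rw [spread, Finset.sum_filter]
      refine le_trans (Finset.sum_le_sum fun S hS => ?_) (Nat.le_add_left _ _)
      have h5 := Finset.single_le_sum (f := fun S => (cutEdges (X S) A).card)
          (fun _ _ => Nat.zero_le _) hS
      have h6 := I.card_cutEdges_ne_one h𝒮 hS (hR S hS) (hXc S hS) hA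
      rw [spread, Finset.mem_filter] at h6
      split_ifs with h7 h8
      · omega
      · have := h6 (fun h => h8 h.2)
        omega
      · have := h6 (fun h => h7 h.1.2)
        omega
    · omega
  refine (Finset.sum_le_sum key).trans ?_
  rw [Finset.sum_add_distrib, ← Finset.mul_sum, Finset.sum_comm]
  refine Nat.add_le_add_left (Finset.sum_le_sum fun S hS => ?_) _
  rw [← Finset.sum_filter, ← Finset.card_eq_sum_ones]
  -- Each component meeting `R S` contains a vertex of `R S`, and these components are among the
  -- touched ones.
  refine le_min ?_ (Finset.card_le_card fun A hA => ?_)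
  · choose c hc hvc using I.exists_stageComps ε k
    refine le_trans (Finset.card_le_card fun A hA => ?_) (Finset.card_image_le (f := c) (s := R S))
    obtain ⟨hA, v, hv⟩ := Finset.mem_filter.1 hA
    rw [Finset.mem_inter] at hv
    exact Finset.mem_image.2 ⟨v, hv.2, I.stageComps_eq_of_mem ε (hc v)
      (I.stageActive_subset ε k hA) (hvc v) hv.1⟩
  · obtain ⟨h1, h2⟩ := Finset.mem_filter.1 hA
    exact I.mem_touching.2 ⟨h1, h2.mono (Finset.inter_subset_inter_left
      (hR S (Finset.mem_filter.1 hS).1))⟩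

/-- The coverage of a stage. -/
theorem stage_coverage (hOPT : I.IsFeasible OPT) (h𝒮 : I.IsAligned ε OPT 𝒮) {k : ℕ}
    (Q : Finset V → Finset ℕ) (p : Finset V → Prop) [DecidablePred p]
    (hp : ∀ S ∈ I.spread ε k 𝒮, I.Clean ε OPT k S → (I.touching ε k S).card ∈ Q S →
      ∀ A ∈ I.touching ε k S, p A) :
    ∑ S ∈ I.spread ε k 𝒮, (if I.Clean ε OPT k S ∧ (I.touching ε k S).card ∈ Q S then
      (I.touching ε k S).card else 0) ≤ ((I.stageActive ε k).filter p).card := by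
  rw [← Finset.sum_filter, ← Finset.card_biUnion]
  · refine Finset.card_le_card fun A hA => ?_
    obtain ⟨S, hS, hAS⟩ := Finset.mem_biUnion.1 hA
    obtain ⟨hS, h1, h2⟩ := Finset.mem_filter.1 hS
    exact Finset.mem_filter.2 ⟨(I.mem_touching.1 hAS).1, hp S hS h1 h2 A hAS⟩
  -- A component without surplus meets at most one spread set, so clean sets touch disjoint
  -- families.
  · intro S hS S' hS' hne
    refine Finset.disjoint_left.2 fun A hA hA' => ?_
    obtain ⟨hS, h1, -⟩ := Finset.mem_filter.1 hS
    obtain ⟨hS', h1', -⟩ := Finset.mem_filter.1 hS'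
    have h2 := I.multiplicity_le_surplus (ε := ε) (𝒮 := 𝒮) hOPT h𝒮 (I.mem_touching.1 hA).1
    rw [h1 A hA] at h2
    have h3 : 1 < I.multiplicity ε k 𝒮 A := Finset.one_lt_card.2
      ⟨S, Finset.mem_filter.2 ⟨hS, (I.mem_touching.1 hA).2⟩, S',
        Finset.mem_filter.2 ⟨hS', (I.mem_touching.1 hA').2⟩, hne⟩
    omega

end Stage

/-! ### Choice of the autarkic tuples -/

section Select

open scoped Classical

variable {ε : ℝ} {OPT : Finset (Sym2 V)} {𝒮 : Finset (Finset V)}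

/-- `S` is split by `A`, so OPT has an edge leaving `A`. Zero surplus forces it to be the only one
and `A` to separate a pair. All separated pairs then lie in the component of OPT around `S`, and
closedness of the collection places them in `S`. -/
theorem sep_nonempty_of_clean (hOPT : I.IsFeasible OPT) (h𝒮 : I.IsAligned ε OPT 𝒮) {S : Finset V}
    (hS : S ∈ 𝒮) {k : ℕ} (hK : 2 ≤ (I.touching ε k S).card) (hc : I.Clean ε OPT k S)
    {A : Finset V} (hA : A ∈ I.touching ε k S) :
    (I.sep A).Nonempty ∧ ∀ d ∈ I.sep A, Satisfies S d := by
  obtain ⟨hAa, u, hu⟩ := I.mem_touching.1 hA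
  obtain ⟨v, hv, hvA⟩ := I.exists_not_mem_of_touching hK hAa
  rw [Finset.mem_inter] at hu
  obtain ⟨T, hT, hST⟩ := h𝒮.exists_component S hS
  have hpos : 0 < (cutEdges OPT A).card := Finset.card_pos.2
    ((((mem_componentSets.1 hT).2 u (hST hu.2) v).1 (hST hv)).exists_cut hu.1 hvA)
  have hcard := I.card_cutEdges_eq hOPT A
  rw [hc A hA] at hcard
  have hsep : (I.sep A).Nonempty := by
    by_contra h
    rw [if_neg h] at hcard
    omega
  rw [if_pos hsep] at hcard
  refine ⟨hsep, fun d hd => ?_⟩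
  exact h𝒮.closed S hS T hT hST k A (I.stageActive_subset ε k hAa) (I.mem_touching.1 hA).2 d hd
    (I.satisfies_of_card_cutEdges_eq_one hOPT hT (by omega) (hST hu.2) (hST hv) hu.1 hvA hd)

/-- The separated demand pairs are determined by the partition of `S`. -/
theorem sep_subset_of_inter {S A B : Finset V} (hA : ∀ d ∈ I.sep A, Satisfies S d)
    (h : (∀ v ∈ S, v ∈ A ↔ v ∈ B) ∨ ∀ v ∈ S, v ∈ A ↔ v ∉ B) : I.sep A ⊆ I.sep B := by
  intro d hd
  have hdS := hA d hd
  obtain ⟨hdD, hcut⟩ := I.mem_sep.1 hd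
  refine I.mem_sep.2 ⟨hdD, ?_⟩
  obtain ⟨a, b, rfl, ha, hb⟩ := hcut.exists_mk
  have haS := hdS a (Sym2.mem_mk_left a b)
  have hbS := hdS b (Sym2.mem_mk_right a b)
  rw [cuts_mk]
  rcases h with h | h
  · have h1 := h a haS; have h2 := h b hbS; tauto
  · have h1 := h a haS; have h2 := h b hbS; tauto

theorem sep_eq_of_inter {S A B : Finset V} (hA : ∀ d ∈ I.sep A, Satisfies S d)
    (hB : ∀ d ∈ I.sep B, Satisfies S d)
    (h : (∀ v ∈ S, v ∈ A ↔ v ∈ B) ∨ ∀ v ∈ S, v ∈ A ↔ v ∉ B) : I.sep A = I.sep B := by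
  refine Finset.Subset.antisymm (I.sep_subset_of_inter hA h) (I.sep_subset_of_inter hB ?_)
  rcases h with h | h
  · exact Or.inl fun v hv => (h v hv).symm
  · exact Or.inr fun v hv => by have := h v hv; tauto

/-- If at most three components touch `S`, then in later stages no new sets of demand pairs are
separated. -/
theorem exists_sep_eq_of_le (hOPT : I.IsFeasible OPT) (h𝒮 : I.IsAligned ε OPT 𝒮) {S : Finset V}
    (hS : S ∈ 𝒮) {k l : ℕ} (hkl : k ≤ l) (hK : 2 ≤ (I.touching ε k S).card)
    (hK3 : (I.touching ε k S).card ≤ 3) (hL : 2 ≤ (I.touching ε l S).card)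
    (hck : I.Clean ε OPT k S) (hcl : I.Clean ε OPT l S) {B : Finset V}
    (hB : B ∈ I.touching ε l S) : ∃ A ∈ I.touching ε k S, I.sep A = I.sep B := by
  obtain ⟨hBa, u, hu⟩ := I.mem_touching.1 hB
  rw [Finset.mem_inter] at hu
  obtain ⟨v, hv, hvB⟩ := I.exists_not_mem_of_touching hL hBa
  have hlam : ∀ A ∈ I.touching ε k S, ∀ w ∈ A, w ∈ B → A ⊆ B := by
    intro A hA w hwA hwB
    obtain ⟨C, hC, hAC⟩ := I.exists_stageComps_superset ε hkl
      (I.stageActive_subset ε k (I.mem_touching.1 hA).1)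
    rwa [I.stageComps_eq_of_mem ε (I.stageActive_subset ε l hBa) hC hwB (hAC hwA)]
  have hcover := fun w (hw : w ∈ S) => I.subset_biUnion_touching h𝒮 hS hK hw
  obtain ⟨A1, hA1, huA1⟩ := hcover u hu.2
  obtain ⟨A2, hA2, hvA2⟩ := hcover v hv
  have hA1B : A1 ⊆ B := hlam A1 hA1 u huA1 hu.1
  have hA2B : ¬ A2 ⊆ B := fun h => hvB (h hvA2)
  have hsum := Finset.card_filter_add_card_filter_not (s := I.touching ε k S) (fun A => A ⊆ B)
  have hpos1 : 0 < ((I.touching ε k S).filter fun A => A ⊆ B).card :=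
    Finset.card_pos.2 ⟨A1, Finset.mem_filter.2 ⟨hA1, hA1B⟩⟩
  have hpos2 : 0 < ((I.touching ε k S).filter fun A => ¬ A ⊆ B).card :=
    Finset.card_pos.2 ⟨A2, Finset.mem_filter.2 ⟨hA2, hA2B⟩⟩
  have hsB := (I.sep_nonempty_of_clean hOPT h𝒮 hS hL hcl hB).2
  -- At most three parts, some inside `B` and some outside: one side is a single part. If it is the
  -- inside, this part has the same trace on `S` as `B`; otherwise it has the complementary trace.
  rcases (by omega : ((I.touching ε k S).filter fun A => A ⊆ B).card ≤ 1 ∨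
    ((I.touching ε k S).filter fun A => ¬ A ⊆ B).card ≤ 1) with h | h
  · refine ⟨A1, hA1, I.sep_eq_of_inter (I.sep_nonempty_of_clean hOPT h𝒮 hS hK hck hA1).2 hsB
      (Or.inl fun w hw => ⟨fun hwA => hA1B hwA, fun hwB => ?_⟩)⟩
    obtain ⟨A, hA, hwA⟩ := hcover w hw
    rwa [Finset.card_le_one.1 h A1 (Finset.mem_filter.2 ⟨hA1, hA1B⟩) A
      (Finset.mem_filter.2 ⟨hA, hlam A hA w hwA hwB⟩)]
  · refine ⟨A2, hA2, I.sep_eq_of_inter (I.sep_nonempty_of_clean hOPT h𝒮 hS hK hck hA2).2 hsB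
      (Or.inr fun w hw => ⟨fun hwA hwB => hA2B (hlam A2 hA2 w hwA hwB), fun hwB => ?_⟩)⟩
    obtain ⟨A, hA, hwA⟩ := hcover w hw
    rwa [Finset.card_le_one.1 h A2 (Finset.mem_filter.2 ⟨hA2, hA2B⟩) A
      (Finset.mem_filter.2 ⟨hA, fun hAB => hwB (hAB hwA)⟩)]

/-- The two components bisect `S`, and both separate exactly the demand pairs inside `S` that are
split by this bisection. -/
theorem isAutarkicPair_touching (hOPT : I.IsFeasible OPT) (h𝒮 : I.IsAligned ε OPT 𝒮)
    {S : Finset V} (hS : S ∈ 𝒮) {k : ℕ} (hk : k < I.lastStage ε)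
    (hK : (I.touching ε k S).card = 2) (hc : I.Clean ε OPT k S) :
    I.IsAutarkicPair ε (I.touching ε k S) := by
  obtain ⟨A, B, hne, hAB⟩ := Finset.card_eq_two.1 hK
  have hA : A ∈ I.touching ε k S := by simp [hAB]
  have hB : B ∈ I.touching ε k S := by simp [hAB]
  have hAa := (I.mem_touching.1 hA).1
  have hBa := (I.mem_touching.1 hB).1
  have hdis := I.touching_disjoint hAa hBa hne
  have h1 := I.sep_nonempty_of_clean hOPT h𝒮 hS hK.ge hc hA
  have h2 := I.sep_nonempty_of_clean hOPT h𝒮 hS hK.ge hc hB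
  refine ⟨A, B, hAB, I.mem_supp_of_mem_stageActive ε hOPT hk hAa,
    I.mem_supp_of_mem_stageActive ε hOPT hk hBa, hdis, ⟨_, I.time_nonneg ε hOPT hk.le,
    I.mem_activeAt_time ε hOPT hk hAa, I.mem_activeAt_time ε hOPT hk hBa⟩,
    I.sep_eq_of_inter h1.2 h2.2 (Or.inr fun v hv =>
      ⟨fun hvA => Finset.disjoint_left.1 hdis hvA, fun hvB => ?_⟩), h1.1⟩
  obtain ⟨C, hC, hvC⟩ := I.subset_biUnion_touching h𝒮 hS hK.ge hv
  rw [hAB, Finset.mem_insert, Finset.mem_singleton] at hC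
  rcases hC with rfl | rfl
  · exact hvC
  · exact absurd hvC hvB

/-- A pair leaving the union would be separated by one of the three components, hence lie in `S`,
which the three components cover. -/
theorem isAutarkicTriple_touching (hOPT : I.IsFeasible OPT) (h𝒮 : I.IsAligned ε OPT 𝒮)
    {S : Finset V} (hS : S ∈ 𝒮) {k : ℕ} (hk : k < I.lastStage ε)
    (hK : (I.touching ε k S).card = 3) (hc : I.Clean ε OPT k S) :
    I.IsAutarkicTriple ε (I.touching ε k S) := by
  obtain ⟨A, B, C, hAB, hAC, hBC, hABC⟩ := Finset.card_eq_three.1 hK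
  have hA : A ∈ I.touching ε k S := by simp [hABC]
  have hB : B ∈ I.touching ε k S := by simp [hABC]
  have hC : C ∈ I.touching ε k S := by simp [hABC]
  have hAa := (I.mem_touching.1 hA).1
  have hBa := (I.mem_touching.1 hB).1
  have hCa := (I.mem_touching.1 hC).1
  have hsep := fun X hX => I.sep_nonempty_of_clean (A := X) hOPT h𝒮 hS (k := k) (by omega) hc hX
  refine ⟨A, B, C, hABC, I.touching_disjoint hAa hBa hAB, I.touching_disjoint hAa hCa hAC,
    I.touching_disjoint hBa hCa hBC, ⟨_, I.time_nonneg ε hOPT hk.le,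
    I.mem_activeAt_time ε hOPT hk hAa, I.mem_activeAt_time ε hOPT hk hBa,
    I.mem_activeAt_time ε hOPT hk hCa⟩, (hsep A hA).1, (hsep B hB).1, (hsep C hC).1, ?_⟩
  refine Finset.eq_empty_of_forall_notMem fun d hd => ?_
  obtain ⟨hdD, hcut⟩ := I.mem_sep.1 hd
  obtain ⟨a, b, rfl, ha, hb⟩ := hcut.exists_mk
  have hex : ∃ X ∈ I.touching ε k S, a ∈ X ∧ b ∉ X := by
    simp only [Finset.mem_union, not_or] at ha hb
    rcases ha with (ha | ha) | ha
    · exact ⟨A, hA, ha, hb.1.1⟩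
    · exact ⟨B, hB, ha, hb.1.2⟩
    · exact ⟨C, hC, ha, hb.2⟩
  obtain ⟨X, hX, haX, hbX⟩ := hex
  have hbS := (hsep X hX).2 _ (I.mem_sep.2 ⟨hdD, cuts_mk.2 (Or.inl ⟨haX, hbX⟩)⟩) b
    (Sym2.mem_mk_right a b)
  obtain ⟨Y, hY, hbY⟩ := I.subset_biUnion_touching (k := k) h𝒮 hS (by omega) hbS
  rw [hABC, Finset.mem_insert, Finset.mem_insert, Finset.mem_singleton] at hY
  refine hb ?_
  simp only [Finset.mem_union]
  rcases hY with rfl | rfl | rfl <;> tauto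

theorem card_filter_mem_sym2_le (z : Sym2 V) : (Finset.univ.filter fun v => v ∈ z).card ≤ 2 := by
  induction z with
  | h a b =>
    refine (Finset.card_le_card fun v hv => ?_).trans (Finset.card_le_two (a := a) (b := b))
    simpa using hv

theorem card_repVertices_pair_le (rep : Finset (Finset V) → Sym2 (Finset V) → Sym2 V)
    {P : Finset (Finset V)} (hP : P.card = 2) : (I.repVertices rep P).card ≤ 2 := by
  obtain ⟨A, B, hAB, rfl⟩ := Finset.card_eq_two.1 hP
  refine (Finset.card_le_card fun v hv => ?_).trans
    (card_filter_mem_sym2_le (rep {A, B} s(A, B)))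
  obtain ⟨X, hX, Y, hY, hne, -, hvr⟩ := (Finset.mem_filter.1 hv).2
  refine Finset.mem_filter.2 ⟨Finset.mem_univ _, ?_⟩
  simp only [Finset.mem_insert, Finset.mem_singleton] at hX hY
  rcases hX with rfl | rfl <;> rcases hY with rfl | rfl
  · exact absurd rfl hne
  · exact hvr
  · rwa [Sym2.eq_swap] at hvr
  · exact absurd rfl hne

theorem card_repVertices_triple_le (rep : Finset (Finset V) → Sym2 (Finset V) → Sym2 V)
    {P : Finset (Finset V)} (hP : P.card = 3) : (I.repVertices rep P).card ≤ 6 := by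
  obtain ⟨A, B, C, hAB, hAC, hBC, rfl⟩ := Finset.card_eq_three.1 hP
  have hsub : I.repVertices rep {A, B, C} ⊆
      ((Finset.univ.filter fun v => v ∈ rep {A, B, C} s(A, B)) ∪
        (Finset.univ.filter fun v => v ∈ rep {A, B, C} s(A, C))) ∪
        (Finset.univ.filter fun v => v ∈ rep {A, B, C} s(B, C)) := by
    intro v hv
    obtain ⟨X, hX, Y, hY, hne, -, hvr⟩ := (Finset.mem_filter.1 hv).2
    simp only [Finset.mem_union, Finset.mem_filter, Finset.mem_univ, true_and]
    simp only [Finset.mem_insert, Finset.mem_singleton] at hX hY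
    rcases hX with rfl | rfl | rfl <;> rcases hY with rfl | rfl | rfl <;>
      first
        | exact absurd rfl hne
        | (have hvr' := hvr; rw [Sym2.eq_swap] at hvr'; tauto)
  have h1 := Finset.card_le_card hsub
  have h2 := Finset.card_union_le ((Finset.univ.filter fun v => v ∈ rep {A, B, C} s(A, B)) ∪
        (Finset.univ.filter fun v => v ∈ rep {A, B, C} s(A, C)))
        (Finset.univ.filter fun v => v ∈ rep {A, B, C} s(B, C))
  have h3 := Finset.card_union_le (Finset.univ.filter fun v => v ∈ rep {A, B, C} s(A, B))
        (Finset.univ.filter fun v => v ∈ rep {A, B, C} s(A, C))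
  have h4 := card_filter_mem_sym2_le (rep {A, B, C} s(A, B))
  have h5 := card_filter_mem_sym2_le (rep {A, B, C} s(A, C))
  have h6 := card_filter_mem_sym2_le (rep {A, B, C} s(B, C))
  omega

/-- Parts can only merge. Two parts at the later stage are required: otherwise `S` could earlier
have been inside one inactive component, touching nothing. -/
theorem card_touching_le_of_le (h𝒮 : I.IsAligned ε OPT 𝒮) {S : Finset V} (hS : S ∈ 𝒮) {k l : ℕ}
    (hkl : k ≤ l) (hK : 2 ≤ (I.touching ε l S).card) :
    (I.touching ε l S).card ≤ (I.touching ε k S).card := by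
  have hne : ∀ A ∈ I.touching ε k S, ∃ B ∈ I.stageComps ε l, A ⊆ B := fun A hA =>
    I.exists_stageComps_superset ε hkl (I.stageActive_subset ε k (I.mem_touching.1 hA).1)
  choose! f hf hfA using hne
  have hl2 : ¬ ∃ A ∈ I.stageComps ε l, S ⊆ A := by
    rintro ⟨A, hA, hSA⟩
    have hall : ∀ B ∈ I.touching ε l S, B = A := by
      intro B hB
      obtain ⟨hB, v, hv⟩ := I.mem_touching.1 hB
      rw [Finset.mem_inter] at hv
      exact I.stageComps_eq_of_mem ε (I.stageActive_subset ε l hB) hA hv.1 (hSA hv.2)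
    have : (I.touching ε l S).card ≤ 1 :=
      Finset.card_le_one.2 fun B hB B' hB' => (hall B hB).trans (hall B' hB').symm
    omega
  have hcov : ∀ v ∈ S, ∃ A ∈ I.touching ε k S, v ∈ A := by
    intro v hv
    rcases h𝒮.active_or_joined S hS k with h | ⟨A, hA, hSA⟩
    · obtain ⟨A, hA, hvA⟩ := h v hv
      exact ⟨A, I.mem_touching.2 ⟨hA, v, Finset.mem_inter.2 ⟨hvA, hv⟩⟩, hvA⟩
    · obtain ⟨B, hB, hAB⟩ := I.exists_stageComps_superset ε hkl hA
      exact absurd ⟨B, hB, hSA.trans hAB⟩ hl2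
  refine Finset.card_le_card_of_surjOn f fun B hB => ?_
  obtain ⟨hBa, v, hv⟩ := I.mem_touching.1 hB
  rw [Finset.mem_inter] at hv
  obtain ⟨A, hA, hvA⟩ := hcov v hv.2
  exact ⟨A, hA, I.stageComps_eq_of_mem ε (hf A hA) (I.stageActive_subset ε l hBa)
    (hfA A hA hvA) hv.1⟩

/-- The balance of a set that touches `K ≥ 2` active components in a stage, is clean iff `c`,
gets coverage if `K ∈ Q`, and whose connector joins at most `ρ` vertices. -/
noncomputable def balance (ρ : ℕ) (Q : Finset ℕ) (K : ℕ) (c : Prop) : ℝ :=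
  -- The terms are, in order: scaled gain minus cost, value, twice the coverage, growth of the
  -- tuple's connector, and a bonus for unclean sets that is paid from the surplus.
  if 2 ≤ K then 10 / 3 * ((K : ℝ) - 2) - K + 2 * ((if c ∧ K ∈ Q then K else 0 : ℕ) : ℝ)
    - ((min ρ K : ℕ) : ℝ) + 4 * (if ¬ c then 1 else 0) else 0

/-- Without a tuple the clean values are `-2` for `K = 2`, `1/3` for `K = 3`, and increasing in `K`;
the bonus `4` outweighs the deficit of an unclean set. -/
theorem balance_nonneg {K : ℕ} {c : Prop} (h : ¬ (c ∧ K = 2)) : 0 ≤ balance 0 ∅ K c := by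
  unfold balance
  by_cases hK : 2 ≤ K
  · rw [if_pos hK]
    have h2 : (2 : ℝ) ≤ K := by exact_mod_cast hK
    by_cases hc : c
    · have h3 : (3 : ℝ) ≤ K := by
        have : K ≠ 2 := fun hK2 => h ⟨hc, hK2⟩
        exact_mod_cast (by omega : 3 ≤ K)
      simp [hc]
      linarith
    · simp [hc]
      linarith
  · rw [if_neg hK]

/-- For clean sets: `-2 + 4 - 2 = 0` at `K = 2`, then `1/3 - 2 = -5/3` at `K = 3` and at least `8/3
- 2 = 2/3` from `K = 4` on. -/
theorem le_balance_pair (K : ℕ) (c : Prop) :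
    2 / 3 * (if c ∧ 4 ≤ K then 1 else 0) - 5 / 3 * (if c ∧ K = 3 then 1 else 0) ≤
      balance 2 {2} K c := by
  unfold balance
  by_cases hK : 2 ≤ K
  · rw [if_pos hK, min_eq_left hK]
    rcases (by omega : K = 2 ∨ K = 3 ∨ 4 ≤ K) with rfl | rfl | h
    · by_cases hc : c <;> simp [hc] <;> norm_num
    · by_cases hc : c <;> simp [hc] <;> norm_num
    · have h4 : (4 : ℝ) ≤ K := by exact_mod_cast h
      have h2 : K ≠ 2 := by omega
      have h3 : K ≠ 3 := by omega
      by_cases hc : c <;> simp [hc, h, h2, h3] <;> linarith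
  · rw [if_neg hK, if_neg (fun h => hK (by omega)), if_neg (fun h => hK (by omega))]
    norm_num

/-- Three representatives have at most six ends. For clean sets: `0` at `K = 2`, `1/3 + 6 - 3 =
10/3` at `K = 3`, the worst value `8/3 - 4 = -4/3` at `K = 4`, and no deficit beyond. -/
theorem le_balance_triple (K : ℕ) (c : Prop) :
    10 / 3 * (if c ∧ K = 3 then 1 else 0) - 4 / 3 * (if c ∧ 4 ≤ K then 1 else 0) ≤
      balance 6 {2, 3} K c := by
  unfold balance
  by_cases hK : 2 ≤ K
  · rw [if_pos hK]
    rcases (by omega : K = 2 ∨ K = 3 ∨ K = 4 ∨ K = 5 ∨ 6 ≤ K) with rfl | rfl | rfl | rfl | h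
    · by_cases hc : c <;> simp [hc] <;> norm_num
    · by_cases hc : c <;> simp [hc] <;> norm_num
    · by_cases hc : c <;> simp [hc] <;> norm_num
    · by_cases hc : c <;> simp [hc] <;> norm_num
    · have h6 : (6 : ℝ) ≤ K := by exact_mod_cast h
      have h2 : K ≠ 2 := by omega
      have h3 : K ≠ 3 := by omega
      have h4 : 4 ≤ K := by omega
      rw [min_eq_left h]
      by_cases hc : c <;> simp [hc, h4, h2, h3] <;> linarith
  · rw [if_neg hK, if_neg (fun h => hK (by omega)), if_neg (fun h => hK (by omega))]
    norm_num

theorem exists_least {p : ℕ → Prop} (h : ∃ k, p k) : ∃ k, p k ∧ ∀ l, p l → k ≤ l :=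
  ⟨Nat.find h, Nat.find_spec h, fun _ hl => Nat.find_min' h hl⟩

/-- For each set of the collection, an autarkic pair, an autarkic triple, or nothing pays for it. -/
theorem exists_autarkic (hOPT : I.IsFeasible OPT) (h𝒮 : I.IsAligned ε OPT 𝒮)
    {S : Finset V} (hS : S ∈ 𝒮) :
    ∃ (𝒬 : Finset (Finset (Finset V))) (ρ : ℕ) (Q : Finset ℕ), 𝒬.card ≤ 1 ∧
      (∀ P ∈ 𝒬, (I.IsAutarkicPair ε P ∨ I.IsAutarkicTriple ε P) ∧
        (∀ A ∈ P, ∀ d ∈ I.sep A, Satisfies S d) ∧ ∀ rep, (I.repVertices rep P).card ≤ ρ) ∧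
      (∀ k < I.lastStage ε, 2 ≤ (I.touching ε k S).card → I.Clean ε OPT k S →
        (I.touching ε k S).card ∈ Q →
          ∀ A ∈ I.touching ε k S, ∃ P ∈ 𝒬, ∃ B ∈ P, I.sep B = I.sep A) ∧
      0 ≤ ∑ k ∈ Finset.range (I.lastStage ε), I.stageDelay ε k *
        balance ρ Q (I.touching ε k S).card (I.Clean ε OPT k S) := by
  have hδ : ∀ k ∈ Finset.range (I.lastStage ε), 0 ≤ I.stageDelay ε k :=
    fun k hk => (I.delay_stage_pos ε hOPT (Finset.mem_range.1 hk)).le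
  by_cases h2 : ∃ k, k < I.lastStage ε ∧ I.Clean ε OPT k S ∧ (I.touching ε k S).card = 2
  swap
  · refine ⟨∅, 0, ∅, by simp, by simp, by simp, Finset.sum_nonneg fun k hk =>
      mul_nonneg (hδ k hk) (balance_nonneg fun h => h2 ⟨k, Finset.mem_range.1 hk, h⟩)⟩
  set g : (ℕ → Prop) → ℝ := fun q => ∑ k ∈ Finset.range (I.lastStage ε), I.stageDelay ε k *
    (if I.Clean ε OPT k S ∧ q (I.touching ε k S).card then 1 else 0) with hg
  have hgnn : ∀ q, 0 ≤ g q := fun q => Finset.sum_nonneg fun k hk =>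
    mul_nonneg (hδ k hk) (by split_ifs <;> norm_num)
  -- The pair is affordable exactly under this bound, as far as `le_balance_pair` shows; its
  -- negation is more than `le_balance_triple` needs.
  by_cases hcase : 5 * g (fun K => K = 3) ≤ 2 * g (fun K => 4 ≤ K)
  · obtain ⟨k, ⟨hk, hc, hK⟩, hmin⟩ := exists_least h2
    refine ⟨{I.touching ε k S}, 2, {2}, by simp, ?_, ?_, ?_⟩
    · intro P hP
      obtain rfl := Finset.mem_singleton.1 hP
      exact ⟨Or.inl (I.isAutarkicPair_touching hOPT h𝒮 hS hk hK hc),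
        fun A hA => (I.sep_nonempty_of_clean hOPT h𝒮 hS hK.ge hc hA).2,
        fun rep => I.card_repVertices_pair_le rep hK⟩
    · intro l hl hL hcl hLQ B hB
      have hL2 : (I.touching ε l S).card = 2 := by simpa using hLQ
      exact ⟨_, Finset.mem_singleton_self _, I.exists_sep_eq_of_le hOPT h𝒮 hS
        (hmin l ⟨hl, hcl, hL2⟩) hK.ge (by omega) hL hc hcl hB⟩
    · have : 2 / 3 * g (fun K => 4 ≤ K) - 5 / 3 * g (fun K => K = 3) ≤
          ∑ k ∈ Finset.range (I.lastStage ε), I.stageDelay ε k *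
            balance 2 {2} (I.touching ε k S).card (I.Clean ε OPT k S) := by
        rw [hg, Finset.mul_sum, Finset.mul_sum, ← Finset.sum_sub_distrib]
        refine Finset.sum_le_sum fun k hk => ?_
        have := mul_le_mul_of_nonneg_left
          (le_balance_pair (I.touching ε k S).card (I.Clean ε OPT k S)) (hδ k hk)
        refine le_trans (le_of_eq ?_) this
        ring_nf
      linarith
  · have h3 : ∃ k, k < I.lastStage ε ∧ I.Clean ε OPT k S ∧ (I.touching ε k S).card = 3 := by
      by_contra! h
      have : g (fun K => K = 3) = 0 := Finset.sum_eq_zero fun k hk => by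
        rw [if_neg fun h' => h k (Finset.mem_range.1 hk) h'.1 h'.2, mul_zero]
      have := hgnn fun K => 4 ≤ K
      linarith
    obtain ⟨k, ⟨hk, hc, hK⟩, hmin⟩ := exists_least h3
    refine ⟨{I.touching ε k S}, 6, {2, 3}, by simp, ?_, ?_, ?_⟩
    · intro P hP
      obtain rfl := Finset.mem_singleton.1 hP
      exact ⟨Or.inr (I.isAutarkicTriple_touching hOPT h𝒮 hS hk hK hc),
        fun A hA => (I.sep_nonempty_of_clean hOPT h𝒮 hS (by omega) hc hA).2,
        fun rep => I.card_repVertices_triple_le rep hK⟩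
    · intro l hl hL hcl hLQ B hB
      have hLQ' : (I.touching ε l S).card = 2 ∨ (I.touching ε l S).card = 3 := by simpa using hLQ
      refine ⟨_, Finset.mem_singleton_self _, I.exists_sep_eq_of_le hOPT h𝒮 hS
        ?_ (by omega) (by omega) hL hc hcl hB⟩
      -- A clean stage with two parts cannot precede the chosen one with three, because the number
      -- of parts never increases up to a stage that still has two.
      rcases hLQ' with hL2 | hL3
      · by_contra! hlt
        have := I.card_touching_le_of_le h𝒮 hS hlt.le (by omega)
        omega
      · exact hmin l ⟨hl, hcl, hL3⟩
    · have : 10 / 3 * g (fun K => K = 3) - 4 / 3 * g (fun K => 4 ≤ K) ≤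
          ∑ k ∈ Finset.range (I.lastStage ε), I.stageDelay ε k *
            balance 6 {2, 3} (I.touching ε k S).card (I.Clean ε OPT k S) := by
        rw [hg, Finset.mul_sum, Finset.mul_sum, ← Finset.sum_sub_distrib]
        refine Finset.sum_le_sum fun k hk => ?_
        have := mul_le_mul_of_nonneg_left
          (le_balance_triple (I.touching ε k S).card (I.Clean ε OPT k S)) (hδ k hk)
        refine le_trans (le_of_eq ?_) this
        ring_nf
      linarith

end Select

/-! ### Summing over all stages -/

section Total

open scoped Classical

variable {ε : ℝ} {OPT : Finset (Sym2 V)} {𝒮 : Finset (Finset V)}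

omit [Fintype V] [DecidableEq V] in
theorem cost_nonneg {F : Finset (Sym2 V)} (hF : ∀ e ∈ F, e ∈ I.graph.edgeSet) : 0 ≤ I.cost F :=
  Finset.sum_nonneg fun e he => I.edgeCost_nonneg e (hF e he)

omit [Fintype V] [DecidableEq V] in
theorem steinerCost_le {R : Finset V} {X : Finset (Sym2 V)} (hX : ∀ e ∈ X, e ∈ I.graph.edgeSet)
    (hXR : ∀ u ∈ R, ∀ v ∈ R, Joins X u v) : I.steinerCost R ≤ I.cost X := by
  refine csInf_le ⟨0, ?_⟩ ⟨X, hX, hXR, rfl⟩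
  rintro x ⟨F, hF, -, rfl⟩
  exact I.cost_nonneg hF

omit [Fintype V] [DecidableEq V] in
theorem steinerCost_nonneg (R : Finset V) : 0 ≤ I.steinerCost R := by
  refine Real.sInf_nonneg ?_
  rintro x ⟨F, hF, -, rfl⟩
  exact I.cost_nonneg hF

/-- The unused capacity of an edge at the end of the algorithm. -/
noncomputable def slack (ε : ℝ) (e : Sym2 V) : ℝ :=
  I.edgeCost e - load (I.stage ε (I.lastStage ε)) e

/-- Each edge cost is slack plus load, and the load grows at the number of active components the
edge leaves. -/
theorem cost_eq (X : Finset (Sym2 V)) : I.cost X = ∑ e ∈ X, I.slack ε e +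
    ∑ k ∈ Finset.range (I.lastStage ε), I.stageDelay ε k *
      ((∑ A ∈ I.stageActive ε k, (cutEdges X A).card : ℕ) : ℝ) := by
  have h : ∑ e ∈ X, load (I.stage ε (I.lastStage ε)) e =
      ∑ k ∈ Finset.range (I.lastStage ε), I.stageDelay ε k *
        ((∑ A ∈ I.stageActive ε k, (cutEdges X A).card : ℕ) : ℝ) := by
    simp only [load_stage]
    rw [Finset.sum_comm]
    refine Finset.sum_congr rfl fun k _ => ?_
    rw [← Finset.mul_sum, ← Nat.cast_sum]
    congr 2
    simp only [cutEdges, Finset.card_eq_sum_ones, Finset.sum_filter]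
    exact Finset.sum_comm
  rw [← h, ← Finset.sum_add_distrib, cost]
  exact Finset.sum_congr rfl fun e _ => by rw [slack]; ring

theorem slack_nonneg (hOPT : I.IsFeasible OPT) : ∀ e ∈ OPT, 0 ≤ I.slack ε e := fun e he =>
  sub_nonneg.2 (I.isPacked_stage ε _ e (hOPT.1 e he))

/-- Subtracting the separating duals removes one crossing per demand-active component; surplus is
what remains. -/
theorem excess_eq (hOPT : I.IsFeasible OPT) : I.excess ε OPT = ∑ e ∈ OPT, I.slack ε e +
    ∑ k ∈ Finset.range (I.lastStage ε), I.stageDelay ε k *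
      ((∑ A ∈ I.stageActive ε k, I.surplus OPT A : ℕ) : ℝ) := by
  rw [excess, I.cost_eq (ε := ε), sum_y_sepSupp, add_sub_assoc, ← Finset.sum_sub_distrib]
  congr 1
  refine Finset.sum_congr rfl fun k _ => ?_
  simp only [I.card_cutEdges_eq hOPT]
  rw [Finset.sum_add_distrib, ← Finset.sum_filter, ← Finset.card_eq_sum_ones]
  push_cast
  ring

/-- The total cost of a local system of edge sets. -/
theorem IsLocalSystem.sum_cost_le (hOPT : I.IsFeasible OPT) (h𝒮 : I.IsAligned ε OPT 𝒮)
    {X : Finset V → Finset (Sym2 V)} (hX : IsLocalSystem OPT 𝒮 X) :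
    ∑ S ∈ 𝒮, I.cost (X S) ≤ ∑ e ∈ OPT, I.slack ε e +
      ∑ k ∈ Finset.range (I.lastStage ε), I.stageDelay ε k *
        ((∑ A ∈ I.stageActive ε k, ∑ S ∈ 𝒮, (cutEdges (X S) A).card : ℕ) : ℝ) := by
  simp only [fun S => I.cost_eq (ε := ε) (X S), Finset.sum_add_distrib]
  refine add_le_add (hX.sum_le I h𝒮 (I.slack_nonneg hOPT)) (le_of_eq ?_)
  rw [Finset.sum_comm]
  refine Finset.sum_congr rfl fun k _ => ?_
  rw [← Finset.mul_sum, ← Nat.cast_sum, Finset.sum_comm]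

theorem IsLocalSystem.mem_edgeSet (hOPT : I.IsFeasible OPT) {X : Finset V → Finset (Sym2 V)}
    (hX : IsLocalSystem OPT 𝒮 X) {S : Finset V} (hS : S ∈ 𝒮) :
    ∀ e ∈ X S, e ∈ I.graph.edgeSet := by
  intro e he
  obtain ⟨T, -, -, hXT⟩ := hX S hS
  exact hOPT.1 e (Finset.mem_filter.1 (hXT he)).1

theorem sum_biUnion_le {ι α : Type*} [DecidableEq α] (s : Finset ι) (t : ι → Finset α)
    {f : α → ℝ} (hf : ∀ a, 0 ≤ f a) : ∑ a ∈ s.biUnion t, f a ≤ ∑ i ∈ s, ∑ a ∈ t i, f a := by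
  induction s using Finset.induction_on with
  | empty => simp
  | insert i s hi ih =>
    rw [Finset.biUnion_insert, Finset.sum_insert hi]
    have h := Finset.sum_union_inter (s₁ := t i) (s₂ := s.biUnion t) (f := f)
    have h2 : 0 ≤ ∑ a ∈ t i ∩ s.biUnion t, f a := Finset.sum_nonneg fun a _ => hf a
    linarith

/-- All estimates of a single stage together. -/
theorem stage_total (hOPT : I.IsFeasible OPT) (h𝒮 : I.IsAligned ε OPT 𝒮)
    {φ : Finset V → Sym2 V} (hφ : I.IsResponsible ε φ)
    {X : Finset V → Finset (Sym2 V)} (hX : IsLocalSystem OPT 𝒮 X)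
    (hXc : ∀ S ∈ 𝒮, IsConnector (X S) S) {R : Finset V → Finset V} (hR : ∀ S ∈ 𝒮, R S ⊆ S)
    {Y : Finset V → Finset (Sym2 V)} (hY : IsLocalSystem OPT 𝒮 Y)
    (hYc : ∀ S ∈ 𝒮, IsConnector (Y S) (R S)) {ρ : Finset V → ℕ}
    (hρ : ∀ S ∈ 𝒮, (R S).card ≤ ρ S) (Q : Finset V → Finset ℕ) (p : Finset V → Prop)
    [DecidablePred p] {k : ℕ} (hk : k < I.lastStage ε)
    (hp : ∀ S ∈ I.spread ε k 𝒮, I.Clean ε OPT k S → (I.touching ε k S).card ∈ Q S →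
      ∀ A ∈ I.touching ε k S, p A) :
    ∑ S ∈ 𝒮, balance (ρ S) (Q S) (I.touching ε k S).card (I.Clean ε OPT k S) ≤
      10 / 3 * (2 * (((I.stageActive ε k).card : ℝ) - (I.stageContract ε k 𝒮).card)) -
      10 / 3 * ((∑ A ∈ I.stageActive ε k, ∑ S ∈ 𝒮, (cutEdges (X S) A).card : ℕ) : ℝ) +
      2 * (((I.stageActive ε k).filter p).card : ℝ) -
      ((∑ A ∈ I.stageActive ε k, ∑ S ∈ 𝒮, (cutEdges (Y S) A).card : ℕ) : ℝ) +
      17 * ((∑ A ∈ I.stageActive ε k, I.surplus OPT A : ℕ) : ℝ) -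
      (((I.stageActive ε k).filter fun U => (I.sep U).Nonempty ∧
        ∃ S ∈ 𝒮, Satisfies S (φ U)).card : ℝ) := by
  have h1 := I.stage_gain hOPT h𝒮 hX hXc k
  have h2 := I.stage_val (𝒮 := 𝒮) hOPT hφ hk
  have h3 := I.stage_not_clean hOPT h𝒮 k
  have h4 := I.stage_connectors hOPT h𝒮 hR hY hYc k
  have h5 := I.stage_coverage hOPT h𝒮 Q p hp
  have h6 : ∑ S ∈ I.spread ε k 𝒮, min (R S).card (I.touching ε k S).card ≤
      ∑ S ∈ I.spread ε k 𝒮, min (ρ S) (I.touching ε k S).card :=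
    Finset.sum_le_sum fun S hS => min_le_min_right _ (hρ S (Finset.mem_filter.1 hS).1)
  have hbal : ∑ S ∈ 𝒮, balance (ρ S) (Q S) (I.touching ε k S).card (I.Clean ε OPT k S) =
      10 / 3 * (((∑ S ∈ I.spread ε k 𝒮, (I.touching ε k S).card : ℕ) : ℝ) -
        2 * (I.spread ε k 𝒮).card) - ((∑ S ∈ I.spread ε k 𝒮, (I.touching ε k S).card : ℕ) : ℝ) +
      2 * ((∑ S ∈ I.spread ε k 𝒮,
        (if I.Clean ε OPT k S ∧ (I.touching ε k S).card ∈ Q S then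
          (I.touching ε k S).card else 0) : ℕ) : ℝ) -
      ((∑ S ∈ I.spread ε k 𝒮, min (ρ S) (I.touching ε k S).card : ℕ) : ℝ) +
      4 * (((I.spread ε k 𝒮).filter fun S => ¬ I.Clean ε OPT k S).card : ℝ) := by
    have hcl : (((I.spread ε k 𝒮).filter fun S => ¬ I.Clean ε OPT k S).card : ℝ) =
        ∑ S ∈ I.spread ε k 𝒮, if ¬ I.Clean ε OPT k S then (1 : ℝ) else 0 := by
      rw [Finset.card_eq_sum_ones, Finset.sum_filter]
      push_cast
      rfl
    have hone : ((I.spread ε k 𝒮).card : ℝ) = ∑ S ∈ I.spread ε k 𝒮, (1 : ℝ) := by simp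
    rw [hcl, hone, Nat.cast_sum, Nat.cast_sum, Nat.cast_sum, Finset.mul_sum, Finset.mul_sum,
      Finset.mul_sum, ← Finset.sum_sub_distrib, Finset.mul_sum, ← Finset.sum_sub_distrib,
      ← Finset.sum_add_distrib, ← Finset.sum_sub_distrib, ← Finset.sum_add_distrib]
    simp only [balance]
    rw [← Finset.sum_filter]
    exact Finset.sum_congr rfl fun S _ => by ring
  rw [hbal]
  have h1' : ((∑ A ∈ I.stageActive ε k, ∑ S ∈ 𝒮, (cutEdges (X S) A).card : ℕ) : ℝ) +
      ((∑ S ∈ I.spread ε k 𝒮, (I.touching ε k S).card : ℕ) : ℝ) +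
      2 * ((I.stageContract ε k 𝒮).card : ℝ) ≤
      2 * ((∑ A ∈ I.stageActive ε k, I.surplus OPT A : ℕ) : ℝ) +
      2 * ((I.stageActive ε k).card : ℝ) + 2 * ((I.spread ε k 𝒮).card : ℝ) := by exact_mod_cast h1
  have h2' := (Nat.cast_le (α := ℝ)).2 h2
  have h3' := (Nat.cast_le (α := ℝ)).2 h3
  have h4' := (Nat.cast_le (α := ℝ)).2 (h4.trans (Nat.add_le_add_left h6 _))
  have h5' := (Nat.cast_le (α := ℝ)).2 h5
  rw [Nat.cast_mul, Nat.cast_ofNat] at h3'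
  rw [Nat.cast_add, Nat.cast_mul, Nat.cast_ofNat] at h4'
  have h7 : (0 : ℝ) ≤ ((∑ A ∈ I.stageActive ε k, I.surplus OPT A : ℕ) : ℝ) := Nat.cast_nonneg _
  -- Surplus needed: `20/3` from gain minus cost, `2` from the tuple connectors and `8` for unclean
  -- sets. The total `50/3` is at most `17`.
  linarith

/-- The main inequality, for any collection with the properties of the canonical collection. -/
theorem exists_autarkic_collection (hOPT : I.IsFeasible OPT) (h𝒮 : I.IsAligned ε OPT 𝒮)
    {φ : Finset V → Sym2 V} (hφ : I.IsResponsible ε φ) :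
    ∃ Ps : Finset (Finset (Finset V)), I.IsAutarkicCollection ε Ps ∧ I.IsCrossingFree Ps ∧
      ∀ rep : Finset (Finset V) → Sym2 (Finset V) → Sym2 V, I.IsRepresentation Ps rep →
        10 / 3 * (I.gain ε 𝒮 - I.collectionCost 𝒮) + I.profit ε rep Ps + 17 * I.excess ε OPT
          ≥ I.val ε φ 𝒮 := by
  choose! 𝒬 ρ Q hcard hP hcov hbal using fun S (hS : S ∈ 𝒮) => I.exists_autarkic hOPT h𝒮 hS
  refine ⟨𝒮.biUnion 𝒬, ?_, ?_, ?_⟩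
  · intro P hPm
    obtain ⟨S, hS, hPS⟩ := Finset.mem_biUnion.1 hPm
    exact (hP S hS P hPS).1
  · intro P hPm P' hPm' hne
    obtain ⟨S, hS, hPS⟩ := Finset.mem_biUnion.1 hPm
    obtain ⟨S', hS', hPS'⟩ := Finset.mem_biUnion.1 hPm'
    refine Finset.disjoint_left.2 fun d hd hd' => hne ?_
    obtain ⟨A, hA, hdA⟩ := Finset.mem_biUnion.1 hd
    obtain ⟨A', hA', hdA'⟩ := Finset.mem_biUnion.1 hd'
    have h1 := (hP S hS P hPS).2.1 A hA d hdA
    have h2 := (hP S' hS' P' hPS').2.1 A' hA' d hdA'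
    -- A common separated pair lies in `S` and in `S'`, hence both lie in one component of OPT and
    -- coincide; and each set contributes at most one tuple.
    obtain ⟨a, ha, -⟩ := (I.mem_sep.1 hdA).2.1
    obtain ⟨T, hT, hST⟩ := h𝒮.exists_component S hS
    obtain ⟨T', hT', hST'⟩ := h𝒮.exists_component S' hS'
    obtain rfl := componentSets_eq_of_mem hT hT' (hST (h1 a ha)) (hST' (h2 a ha))
    obtain rfl := h𝒮.eq_of_subset S hS S' hS' T hT hST hST'
    exact Finset.card_le_one.1 (hcard S hS) P hPS P' hPS'
  · intro rep hrep
    -- The terminals of the tuple of `S`. They lie in `S`, since its members separate only pairs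
    -- inside `S`, so OPT supplies a connector for them.
    set R : Finset V → Finset V := fun S => (𝒬 S).biUnion fun P => I.repVertices rep P with hRdef
    have hR : ∀ S ∈ 𝒮, R S ⊆ S := by
      intro S hS v hv
      obtain ⟨P, hPS, hv⟩ := Finset.mem_biUnion.1 hv
      obtain ⟨A, hA, B, hB, hne, hsep, hvr⟩ := (Finset.mem_filter.1 hv).2
      have := hrep P (Finset.mem_biUnion.2 ⟨S, hS, hPS⟩) A hA B hB hne hsep
      exact (hP S hS P hPS).2.1 A hA _ (Finset.mem_inter.1 this).1 v hvr
    have hρ : ∀ S ∈ 𝒮, (R S).card ≤ ρ S := by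
      intro S hS
      refine Finset.card_biUnion_le.trans ?_
      refine (Finset.sum_le_card_nsmul _ _ (ρ S) fun P hPS => (hP S hS P hPS).2.2 rep).trans ?_
      rw [smul_eq_mul]
      exact (Nat.mul_le_mul_right _ (hcard S hS)).trans (one_mul _).le
    obtain ⟨X, hX, hXc⟩ := I.exists_connector_system h𝒮 id fun S _ => Finset.Subset.refl S
    obtain ⟨Y, hY, hYc⟩ := I.exists_connector_system h𝒮 R hR
    have hcostX : I.collectionCost 𝒮 ≤ ∑ S ∈ 𝒮, I.cost (X S) := Finset.sum_le_sum fun S hS =>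
      I.steinerCost_le (hX.mem_edgeSet I hOPT hS) (hXc S hS).joins
    have hcostY : I.tupleCost rep (𝒮.biUnion 𝒬) ≤ ∑ S ∈ 𝒮, I.cost (Y S) := by
      refine (sum_biUnion_le _ _ fun P => I.steinerCost_nonneg _).trans
        (Finset.sum_le_sum fun S hS => ?_)
      have hedge := hY.mem_edgeSet I hOPT hS
      refine (Finset.sum_le_card_nsmul _ _ (I.cost (Y S)) fun P hPS =>
        I.steinerCost_le hedge fun u hu v hv => (hYc S hS).joins u
          (Finset.mem_biUnion.2 ⟨P, hPS, hu⟩) v (Finset.mem_biUnion.2 ⟨P, hPS, hv⟩)).trans ?_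
      rw [nsmul_eq_mul]
      exact mul_le_of_le_one_left (I.cost_nonneg hedge) (by exact_mod_cast hcard S hS)
    have hsX := hX.sum_cost_le I hOPT h𝒮
    have hsY := hY.sum_cost_le I hOPT h𝒮
    -- The two systems of connectors use the slack of OPT at most `10/3 + 1` times, which the factor
    -- `17` covers.
    have hslack := Finset.sum_nonneg (I.slack_nonneg (ε := ε) hOPT)
    have hstage := fun k (hk : k ∈ Finset.range (I.lastStage ε)) =>
      mul_le_mul_of_nonneg_left (I.stage_total hOPT h𝒮 hφ hX hXc hR hY hYc hρ Q
        (fun U => ∃ P ∈ 𝒮.biUnion 𝒬, ∃ A ∈ P, I.sep A = I.sep U) (Finset.mem_range.1 hk)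
        (fun S hS hc hQ A hA => by
          obtain ⟨hS, hK⟩ := Finset.mem_filter.1 hS
          obtain ⟨P, hPS, B, hB, hsep⟩ := hcov S hS k (Finset.mem_range.1 hk) hK hc hQ A hA
          exact ⟨P, Finset.mem_biUnion.2 ⟨S, hS, hPS⟩, B, hB, hsep⟩))
        (I.delay_stage_pos ε hOPT (Finset.mem_range.1 hk)).le
    have hsum := Finset.sum_le_sum hstage
    have hleft : 0 ≤ ∑ k ∈ Finset.range (I.lastStage ε), I.delay (I.stage ε k) *
        ∑ S ∈ 𝒮, balance (ρ S) (Q S) (I.touching ε k S).card (I.Clean ε OPT k S) := by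
      simp only [Finset.mul_sum]
      rw [Finset.sum_comm]
      exact Finset.sum_nonneg hbal
    rw [I.excess_eq hOPT, profit, I.coverage_eq, I.val_eq ε hφ, I.gain_eq ε hOPT]
    have hright := hleft.trans hsum
    simp only [mul_add, mul_sub, Finset.sum_add_distrib, Finset.sum_sub_distrib,
      mul_left_comm (I.delay (I.stage ε _)), ← Finset.mul_sum] at hright
    simp only [mul_sub, Finset.sum_sub_distrib, mul_left_comm (I.stageDelay ε _),
      ← Finset.mul_sum]
    simp only [stageDelay] at hsX hsY ⊢
    linarith

end Total

end SteinerForest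

theorem mainTheorem6 {V : Type*} [Fintype V] [DecidableEq V] (I : SteinerForest V)
    (ε : ℝ) (hε : 0 ≤ ε)
    (OPT : Finset (Sym2 V)) (hOPT : I.IsMinimalOptimum OPT)
    (φ : Finset V → Sym2 V) (hφ : I.IsResponsible ε φ)
    (r : Finset V → V) (hr : I.IsRootChoice ε OPT r) :
    ∃ Ps : Finset (Finset (Finset V)), I.IsAutarkicCollection ε Ps ∧ I.IsCrossingFree Ps ∧
      ∀ rep : Finset (Finset V) → Sym2 (Finset V) → Sym2 V, I.IsRepresentation Ps rep →
        10 / 3 * (I.gain ε (I.canonical ε OPT r) - I.collectionCost (I.canonical ε OPT r))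
            + I.profit ε rep Ps + 17 * I.excess ε OPT
          ≥ I.val ε φ (I.canonical ε OPT r) :=
  I.exists_autarkic_collection hOPT.1 (SteinerForest.canonical_isAligned hOPT.1 hr) hφ
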